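/- Let $\mathcal T=(P_n)_{n\in\mathbb N}$ be a tiling of the Euclidean plane by convex compact polygons, i.e. $\mathbb R^2=\bigcup_n P_n$ and $P_n\cap P_m\subset\partial P_n$ for $n\neq m$ (the tiling need not be edge-to-edge), and let $G=\bigcup_n\partial P_n$ be its one-skeleton. A point $v\in G$ is a vertex of $G$ if every neighbourhood of $v$ meets at least three tiles; an edge of $G$ is an open straight-line segment $e\subset G$ whose two end points are distinct vertices of $G$ and whose closure contains no other vertex; $l_e$ is its length. Assume that the edge lengths are bounded away from $0$, that every $P\in\mathcal T$ has an incircle (a circle contained in $P$ and tangent to all sides of $P$), of radius $r_P$, and that there are constants $h_{\mathcal T}, H_{\mathcal T}, M_{\mathcal T}$ with $$0<h_{\mathcal T}\le r_P\le H_{\mathcal T},\qquad |\partial P|\le M_{\mathcal T}\qquad\text{for all }P\in\mathcal T,$$ where $|\partial P|$ is the length of $\partial P$. Let $\mu$ be the one-dimensional Hausdorff measure on $G$ and $L^p(G)=L^p(G,\mu)$. Let $H^1(G)$ be the set of all $f\in L^2(G)$ that are continuous on $G$, belong to the Sobolev space $H^1(e)$ on every edge $e$ (identified with the interval $(0,l_e)$),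 and whose edgewise weak derivative $f'$ is in $L^2(G)$; for such $f$ put $Q(f)=\int_G (f')^2\,d\mu$. Theorem. There is a constant $\beta_2>0$, depending only on $h_{\mathcal T}, H_{\mathcal T}, M_{\mathcal T}$, such that every $f\in H^1(G)\cap L^1(G)$ with $f\ge 0$ satisfies $$\|f\|_{L^2(G)}^4\le\beta_2\,Q(f)\,\|f\|_{L^1(G)}^2 .$$ -/

import Mathlib

open MeasureTheory Set Topology
open scoped ENNReal ContDiff

/-- The Euclidean plane. -/
abbrev Plane : Type := EuclideanSpace ℝ (Fin 2)

/-- The signed area of the parallelogram spanned by `a` and `b`; it is positive iff `b` points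
strictly to the left of `a`. -/
def cross (a b : Plane) : ℝ := a 0 * b 1 - a 1 * b 0

/-- A convex polygon, given by its corners in anticlockwise order: every other corner lies strictly
to the left of the directed line through a corner and its (cyclic) successor. -/
structure ConvexPolygon where
  /-- The number of corners. -/
  n : ℕ
  three_le : 3 ≤ n
  /-- The cyclic list of corners. -/
  poly : Polygon Plane n
  left_of : ∀ i j : Fin n, j ≠ i → j ≠ finRotate n i →
    0 < cross (poly (finRotate n i) - poly i) (poly j - poly i)

namespace ConvexPolygon

/-- The (compact, convex) region bounded by the polygon. -/
def carrier (P : ConvexPolygon) : Set Plane := convexHull ℝ (range P.poly.vertices)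

/-- The boundary `∂P`, the union of the sides. -/
def boundary (P : ConvexPolygon) : Set Plane := P.poly.boundary ℝ

/-- The length `|∂P|` of the boundary. -/
noncomputable def perimeter (P : ConvexPolygon) : ℝ :=
  ∑ i, dist (P.poly i) (P.poly (finRotate P.n i))

/-- The circle with centre `x` and radius `r` is the incircle of `P`: it is inscribed in `P` and
touches every side of `P` (being inscribed, it is then tangent to every side). -/
def IsIncircle (P : ConvexPolygon) (x : Plane) (r : ℝ) : Prop :=
  0 < r ∧ Metric.closedBall x r ⊆ P.carrier ∧
    ∀ i, (Metric.sphere x r ∩ P.poly.edgeSet ℝ i).Nonempty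

end ConvexPolygon

/-- A tiling of the plane by convex compact polygons, not necessarily edge-to-edge. -/
structure PolygonalTiling where
  /-- The tiles. -/
  tile : ℕ → ConvexPolygon
  cover : ⋃ n, (tile n).carrier = univ
  inter_subset : ∀ n m, n ≠ m → (tile n).carrier ∩ (tile m).carrier ⊆ (tile n).boundary

/-- On the interval `(0, l)`, the function `u` belongs to the Sobolev space `H¹(0, l)` and `w` is
its weak derivative. -/
def HasH1Deriv (l : ℝ) (u w : ℝ → ℝ) : Prop :=
  MemLp u 2 (volume.restrict (Ioo 0 l)) ∧ MemLp w 2 (volume.restrict (Ioo 0 l)) ∧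
    ∀ φ : ℝ → ℝ, ContDiff ℝ ∞ φ → HasCompactSupport φ → tsupport φ ⊆ Ioo 0 l →
      ∫ t in Ioo 0 l, u t * deriv φ t = - ∫ t in Ioo 0 l, w t * φ t

/-- The arclength parametrization of the segment from `a` (at `0`) to `b` (at `dist a b`). -/
noncomputable def arcParam (a b : Plane) (t : ℝ) : Plane := AffineMap.lineMap a b (t / dist a b)

namespace PolygonalTiling

variable (T : PolygonalTiling)

/-- The one-skeleton `G` of the tiling. -/
def graph : Set Plane := ⋃ n, (T.tile n).boundary

/-- The vertices of `G` are its branching points: every neighbourhood meets at least three tiles. -/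
def vertices : Set Plane :=
  {v | v ∈ T.graph ∧ ∀ N ∈ 𝓝 v, 3 ≤ {n | ((T.tile n).carrier ∩ N).Nonempty}.encard}

/-- `a` and `b` are the two end points of an edge of `G`; the edge is `openSegment ℝ a b`. -/
def IsEdge (a b : Plane) : Prop :=
  a ≠ b ∧ openSegment ℝ a b ⊆ T.graph ∧ segment ℝ a b ∩ T.vertices = {a, b}

/-- The standing assumptions on a tiling, with parameters `h`, `H`, `M`: every tile has an incircle,
whose radius lies between `h` and `H`, the length of the boundary of every tile is at most `M`, and
the edge lengths are bounded away from `0`. -/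
structure Admissible (h H M : ℝ) : Prop where
  incircle : ∀ n, ∃ x r, (T.tile n).IsIncircle x r ∧ h ≤ r ∧ r ≤ H
  perimeter_le : ∀ n, (T.tile n).perimeter ≤ M
  edge_length : ∃ l > 0, ∀ a b, T.IsEdge a b → l ≤ dist a b

/-- The length measure on `G`: the one-dimensional Hausdorff measure restricted to `G`. -/
noncomputable def lengthMeasure : Measure Plane :=
  (Measure.hausdorffMeasure 1 : Measure Plane).restrict T.graph

/-- A function on `G` is represented by a function on the plane of which only the values on `G` are
ever used. `T.IsDeriv f f'` says that, on every edge `e` of `G`, identified with the interval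
`(0, l_e)` in one of the two possible directions, `f` is in `H¹(e)` with weak derivative `f'`. -/
def IsDeriv (f f' : Plane → ℝ) : Prop :=
  ∀ a b, T.IsEdge a b →
    HasH1Deriv (dist a b) (f ∘ arcParam a b) (f' ∘ arcParam a b) ∨
      HasH1Deriv (dist b a) (f ∘ arcParam b a) (f' ∘ arcParam b a)

/-- `f ∈ H¹(G)`: `f ∈ L²(G)` is continuous on `G`, is in `H¹(e)` for every edge `e`, and
`f' ∈ L²(G)`. -/
def MemH1 (f : Plane → ℝ) : Prop :=
  MemLp f 2 T.lengthMeasure ∧ ContinuousOn f T.graph ∧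
    ∃ f', T.IsDeriv f f' ∧ MemLp f' 2 T.lengthMeasure

open Classical in
/-- The Dirichlet form `Q(f) = ∫_G (f')² dμ` for `f ∈ H¹(G)`. The function `(f')²` is determined
almost everywhere on `G` by `f`, so the choice of `f'` is immaterial. The value outside the domain
`H¹(G)` is `0` by convention. -/
noncomputable def energy (f : Plane → ℝ) : ℝ :=
  if hf : T.MemH1 f then ∫ x, (hf.2.2.choose x) ^ 2 ∂T.lengthMeasure else 0

end PolygonalTiling

/-! The inequality is Nash's in dimension two. It follows from a Gagliardo–Nirenberg type embedding
applied to `u = f²`: `∫ u²` is at most a constant times `(∫ |2 f f'|)²`. Cauchy–Schwarz bounds the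
right side by `‖f‖₂² Q(f)`, while Hölder gives `‖f‖₂⁶ ≤ ‖f‖₁² ∫ f⁴`. Combining the two and
cancelling one factor `‖f‖₂²` gives the claim.

The embedding (`sobolev`) is the slicing proof carried over to the graph. Take a line parallel to an
axis through a tile. If a level `c` below some value of `u` on that tile's boundary were attained on
no boundary of a tile meeting the line, connectedness of the boundaries and of the line would force
`u > c` on all of them. There are infinitely many, each of length at least `h/2`, so `u` would not
be integrable. Hence `u` is at most the sum of the lengths of the ranges of `u` on these boundaries
(`le_tsum_volume_image`), and each range is no longer than `∫ |2 f f'|` over its boundary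
(`volume_image_boundary_le`). This bounds `sup u` on a tile boundary by a function of either
coordinate alone. The product of the two bounds is integrated over disjoint balls of radius `h` in
the tiles, and Tonelli separates the variables. Packing these balls also bounds how often a point of
`G` is counted.

The range estimate needs care, since a side may contain vertices of `G` in its interior and the
Sobolev condition is imposed edge by edge. The corners are vertices, the vertices form a closed
countable set, and continuity of `f` allows the estimates on edges to be glued across that set. -/

/-! ### One-variable analysis: gluing of increments and continuous `H¹` functions. -/

/-- A continuous function on `[a, b]` which is locally monotone off a countable set satisfies
`H a ≤ H b`. -/
theorem le_of_locally_monotone_off_countable {a b : ℝ} (hab : a ≤ b) {H : ℝ → ℝ}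
    (hH : ContinuousOn H (Icc a b)) {Z : Set ℝ} (hZ : Z.Countable)
    (hloc : ∀ x ∈ Ioo a b, x ∉ Z → ∃ c d, x ∈ Ioo c d ∧ MonotoneOn H (Ioo c d)) :
    H a ≤ H b := by
  by_contra! hlt
  have hu : ¬ (Ioo (H b) (H a)).Countable := by
    intro h
    exact (Cardinal.Real.Ioo_countable_iff.1 h).not_gt hlt
  -- A level avoided by the countable set `H '' Z`, so that every point where it is attained admits
  -- local monotonicity.
  obtain ⟨c, hc, hcZ⟩ : ∃ c ∈ Ioo (H b) (H a), c ∉ H '' Z := by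
    by_contra! h
    exact hu ((hZ.image H).mono h)
  let S := Icc a b ∩ H ⁻¹' {c}
  have hScl : IsClosed S := hH.preimage_isClosed_of_isClosed isClosed_Icc isClosed_singleton
  have hSc : IsCompact S := isCompact_Icc.of_isClosed_subset hScl inter_subset_left
  have hSne : S.Nonempty := by
    obtain ⟨x, hx, hxc⟩ := intermediate_value_Icc' hab hH ⟨hc.1.le, hc.2.le⟩
    exact ⟨x, hx, hxc⟩
  -- At the last point `t` with `H t = c`, monotonicity gives `H ≥ c` just to the right; since `H b
  -- < c`, the level is attained again later, a contradiction.
  obtain ⟨t, ⟨htI, htc⟩, htmax⟩ := hSc.exists_isGreatest hSne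
  have htc : H t = c := htc
  have hta : a < t := lt_of_le_of_ne htI.1 fun h => by rw [h, htc] at hc; exact lt_irrefl _ hc.2
  have htb : t < b := lt_of_le_of_ne htI.2 fun h => by rw [← h, htc] at hc; exact lt_irrefl _ hc.1
  have htZ : t ∉ Z := fun h => hcZ ⟨t, h, htc⟩
  obtain ⟨p, q, htpq, hmono⟩ := hloc t ⟨hta, htb⟩ htZ
  obtain ⟨s, hts, hs⟩ := exists_between (lt_min htpq.2 htb)
  have hsq := hs.trans_le (min_le_left _ _)
  have hsb := hs.trans_le (min_le_right _ _)
  have h1 : c ≤ H s := htc ▸ hmono htpq ⟨htpq.1.trans hts, hsq⟩ hts.le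
  obtain ⟨x, hx, hxc⟩ := intermediate_value_Icc' hsb.le
    (hH.mono (Icc_subset_Icc_left (hta.le.trans hts.le))) ⟨hc.1.le, h1⟩
  have : x ≤ t := htmax ⟨⟨hta.le.trans (hts.le.trans hx.1), hx.2⟩, hxc⟩
  linarith [hx.1]

/-- A continuous function whose increments are locally, off a countable set, bounded by the integral
of an integrable function satisfies the same bound globally. -/
theorem abs_sub_le_integral_of_locally {L : ℝ} {F g : ℝ → ℝ}
    (hF : ContinuousOn F (Icc 0 L)) (hg : IntegrableOn g (Icc 0 L)) {Z : Set ℝ} (hZ : Z.Countable)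
    (hloc : ∀ x ∈ Ioo 0 L, x ∉ Z → ∃ c d, x ∈ Ioo c d ∧ Ioo c d ⊆ Icc 0 L ∧
      ∀ s ∈ Ioo c d, ∀ t ∈ Ioo c d, s ≤ t → |F t - F s| ≤ ∫ x in s..t, g x)
    {s t : ℝ} (hs : 0 ≤ s) (hst : s ≤ t) (ht : t ≤ L) :
    |F t - F s| ≤ ∫ x in s..t, g x := by
  have h0L : (0 : ℝ) ≤ L := hs.trans (hst.trans ht)
  have hii : ∀ x ∈ Icc 0 L, ∀ y ∈ Icc 0 L, IntervalIntegrable g volume x y := fun x hx y hy =>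
    (hg.mono_set ((uIcc_subset_Icc hx hy))).intervalIntegrable
  have hprim : ContinuousOn (fun x => ∫ y in (0 : ℝ)..x, g y) (Icc 0 L) := by
    have := intervalIntegral.continuousOn_primitive_interval (μ := volume) (f := g) (a := 0) (b := L)
      (by rwa [uIcc_of_le h0L])
    rwa [uIcc_of_le h0L] at this
  have hdiff : ∀ x ∈ Icc 0 L, ∀ y ∈ Icc 0 L,
      (∫ z in (0 : ℝ)..y, g z) - ∫ z in (0 : ℝ)..x, g z = ∫ z in x..y, g z := fun x hx y hy =>
    intervalIntegral.integral_interval_sub_left (hii 0 ⟨le_rfl, h0L⟩ y hy) (hii 0 ⟨le_rfl, h0L⟩ x hx)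
  have hsI : s ∈ Icc 0 L := ⟨hs, hst.trans ht⟩
  have htI : t ∈ Icc 0 L := ⟨hs.trans hst, ht⟩
  have hsub : Icc s t ⊆ Icc 0 L := Icc_subset_Icc hs ht
  -- For either sign, the primitive of `g` minus `ε F` is locally monotone off `Z`.
  have key : ∀ ε : ℝ, |ε| = 1 → ε * (F t - F s) ≤ ∫ x in s..t, g x := by
    intro ε hε
    have := le_of_locally_monotone_off_countable hst
      (H := fun x => (∫ y in (0 : ℝ)..x, g y) - ε * F x)
      ((hprim.sub (hF.const_smul ε)).mono hsub) hZ (fun x hx hxZ => by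
        obtain ⟨c, d, hxcd, hcd, hb⟩ := hloc x ⟨hs.trans_lt hx.1, hx.2.trans_le ht⟩ hxZ
        refine ⟨c, d, hxcd, fun p hp q hq hpq => ?_⟩
        have h1 := hb p hp q hq hpq
        have h2 := hdiff p (hcd hp) q (hcd hq)
        have h3 : ε * (F q - F p) ≤ |F q - F p| := by
          calc _ ≤ |ε * (F q - F p)| := le_abs_self _
            _ = _ := by rw [abs_mul, hε, one_mul]
        simp only
        linarith)
    have h2 := hdiff s hsI t htI
    linarith
  have h1 := key 1 (by simp)
  have h2 := key (-1) (by simp)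
  exact abs_le.2 ⟨by linarith, by linarith⟩

/-- Integration by parts of a primitive against a test function. -/
theorem integral_primitive_mul_deriv {l : ℝ} (hl : 0 < l) {w : ℝ → ℝ}
    (hw : IntervalIntegrable w volume 0 l) {φ : ℝ → ℝ} (hφ : ContDiff ℝ ∞ φ)
    (hsupp : tsupport φ ⊆ Ioo 0 l) :
    ∫ t in Ioo 0 l, (∫ y in (0 : ℝ)..t, w y) * deriv φ t = - ∫ t in Ioo 0 l, w t * φ t := by
  have hW := hw.absolutelyContinuousOnInterval_intervalIntegral (c := 0) (by simp)
  have hφ' : AbsolutelyContinuousOnInterval φ 0 l :=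
    (hφ.contDiffOn.of_le (by simp)).absolutelyContinuousOnInterval
  have h := hW.integral_mul_deriv_eq_deriv_mul hφ'
  have h0 : φ l = 0 := image_eq_zero_of_notMem_tsupport fun h => by simpa using hsupp h
  have hd : ∫ x in (0 : ℝ)..l, deriv (fun x => ∫ y in (0 : ℝ)..x, w y) x * φ x
      = ∫ x in (0 : ℝ)..l, w x * φ x := by
    apply intervalIntegral.integral_congr_ae
    filter_upwards [hw.ae_hasDerivAt_integral] with x hx hxI
    rw [(hx (uIoc_subset_uIcc hxI) 0 (by simp)).deriv]
  rw [hd, h0] at h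
  simp only [mul_zero, intervalIntegral.integral_same, zero_mul, sub_zero, zero_sub] at h
  rwa [intervalIntegral.integral_of_le hl.le, intervalIntegral.integral_of_le hl.le,
    integral_Ioc_eq_integral_Ioo, integral_Ioc_eq_integral_Ioo] at h

/-- The lemma of du Bois-Reymond for continuous functions. -/
theorem eqOn_const_of_integral_mul_deriv_eq_zero {l : ℝ} (hl : 0 < l) {v : ℝ → ℝ}
    (hv : ContinuousOn v (Ioo 0 l)) (hvi : IntegrableOn v (Ioo 0 l))
    (h : ∀ φ : ℝ → ℝ, ContDiff ℝ ∞ φ → HasCompactSupport φ → tsupport φ ⊆ Ioo 0 l →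
      ∫ t in Ioo 0 l, v t * deriv φ t = 0) :
    ∃ c, ∀ x ∈ Ioo 0 l, v x = c := by
  let B : ContDiffBump (l / 2) := ⟨l / 8, l / 4, by positivity, by linarith⟩
  let η : ℝ → ℝ := B.normed volume
  have hη : ContDiff ℝ ∞ η := B.contDiff_normed
  have hηt : tsupport η = Metric.closedBall (l / 2) (l / 4) := B.tsupport_normed_eq
  have hηi : ∫ x, η x = 1 := B.integral_normed
  have hηc : HasCompactSupport η := B.hasCompactSupport_normed
  have hηs : tsupport η ⊆ Ioo 0 l := by
    rw [hηt, Real.closedBall_eq_Icc]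
    exact fun x hx => ⟨by linarith [hx.1], by linarith [hx.2]⟩
  let c := ∫ t in Ioo 0 l, v t * η t
  have hmulint : ∀ ψ : ℝ → ℝ, Continuous ψ → HasCompactSupport ψ →
      IntegrableOn (fun t => v t * ψ t) (Ioo 0 l) := by
    intro ψ hψ hψc
    obtain ⟨C, hC⟩ := hψc.exists_bound_of_continuous hψ
    exact hvi.mul_bdd hψ.aestronglyMeasurable (Filter.Eventually.of_forall hC)
  have hae : ∀ᵐ x, x ∈ Ioo 0 l → v x - c = 0 := by
    refine isOpen_Ioo.ae_eq_zero_of_integral_contDiff_smul_eq_zero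
      ((hv.sub continuousOn_const).locallyIntegrableOn measurableSet_Ioo) fun ψ hψ hψc hψs => ?_
    -- Subtracting the right multiple of the bump `η` makes the mean zero, so the primitive `φ` of
    -- `ρ` is again a test function. Testing `v` against `φ' = ρ` yields `∫ v ψ = c ∫ ψ`.
    let ρ : ℝ → ℝ := fun x => ψ x - (∫ y, ψ y) * η x
    have hρ : ContDiff ℝ ∞ ρ := hψ.sub (contDiff_const.mul hη)
    have hψi : Integrable ψ := hψ.continuous.integrable_of_hasCompactSupport hψc
    have hηint : Integrable η := hη.continuous.integrable_of_hasCompactSupport hηc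
    have hρ0 : ∫ x, ρ x = 0 := by
      simp only [ρ]
      rw [integral_sub hψi (hηint.const_mul _), integral_const_mul, hηi]
      simp
    let φ : ℝ → ℝ := fun x => ∫ y in (0 : ℝ)..x, ρ y
    have hderiv : ∀ x, HasDerivAt φ (ρ x) x := fun x =>
      (hρ.continuous.integral_hasStrictDerivAt 0 x).hasDerivAt
    have hφ' : deriv φ = ρ := funext fun x => (hderiv x).deriv
    have hφ : ContDiff ℝ ∞ φ :=
      contDiff_infty_iff_deriv.2 ⟨fun x => (hderiv x).differentiableAt, hφ' ▸ hρ⟩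
    obtain ⟨a, b, ha, hb, hK⟩ : ∃ a b : ℝ, 0 < a ∧ b < l ∧
        ∀ x, x ∉ Icc a b → ρ x = 0 := by
      have hKc : IsCompact (tsupport ψ ∪ tsupport η) := hψc.isCompact.union hηc.isCompact
      have hKne : (tsupport ψ ∪ tsupport η).Nonempty := by
        refine ⟨l / 2, Or.inr ?_⟩
        rw [hηt]
        exact Metric.mem_closedBall_self (by positivity)
      have hKs := union_subset hψs hηs
      obtain ⟨a, haK, ha⟩ := hKc.exists_isLeast hKne
      obtain ⟨b, hbK, hb⟩ := hKc.exists_isGreatest hKne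
      refine ⟨a, b, (hKs haK).1, (hKs hbK).2, fun x hx => ?_⟩
      have h1 : x ∉ tsupport ψ := fun h => hx ⟨ha (Or.inl h), hb (Or.inl h)⟩
      have h2 : x ∉ tsupport η := fun h => hx ⟨ha (Or.inr h), hb (Or.inr h)⟩
      simp [ρ, image_eq_zero_of_notMem_tsupport h1, image_eq_zero_of_notMem_tsupport h2]
    have hφ0 : ∀ x, x ∉ Icc a b → φ x = 0 := by
      intro x hx
      rcases lt_or_ge x a with hxa | hxa
      · have : EqOn ρ (fun _ => 0) (uIcc 0 x) := fun y hy =>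
          hK y fun hy' => by
            have := hy.2
            rcases le_total 0 x with h0 | h0
            · rw [sup_of_le_right h0] at this; linarith [hy'.1]
            · rw [sup_of_le_left h0] at this; linarith [hy'.1]
        simp only [φ]
        rw [intervalIntegral.integral_congr this]
        simp
      · have hxb : b < x := by
          by_contra! h
          exact hx ⟨hxa, h⟩
        simp only [φ]
        rw [intervalIntegral.integral_eq_integral_of_support_subset, hρ0]
        intro y hy
        have : y ∈ Icc a b := by
          by_contra h
          exact hy (hK y h)
        exact ⟨ha.trans_le this.1, this.2.trans hxb.le⟩
    have hφt : tsupport φ ⊆ Icc a b := closure_minimal (fun x hx => by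
      by_contra h
      exact hx (hφ0 x h)) isClosed_Icc
    have hz := h φ hφ (isCompact_Icc.of_isClosed_subset (isClosed_tsupport _) hφt)
      (hφt.trans fun x hx => ⟨ha.trans_le hx.1, hx.2.trans_lt hb⟩)
    rw [hφ'] at hz
    have hz2 : ∫ t in Ioo 0 l, v t * ψ t = (∫ y, ψ y) * c := by
      have h1 : ∀ t, v t * ρ t = v t * ψ t - (∫ y, ψ y) * (v t * η t) := fun t => by
        simp only [ρ]; ring
      simp only [h1] at hz
      rw [integral_sub (hmulint ψ hψ.continuous hψc)
        ((hmulint η hη.continuous hηc).const_mul _), integral_const_mul] at hz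
      linarith
    have hout : ∀ x, x ∉ Ioo 0 l → ψ x = 0 := fun x hx =>
      image_eq_zero_of_notMem_tsupport fun h => hx (hψs h)
    rw [← setIntegral_eq_integral_of_forall_compl_eq_zero (s := Ioo 0 l)
      (fun x hx => by simp [hout x hx])]
    have h1 : ∀ t, ψ t • (v t - c) = v t * ψ t - c * ψ t := fun t => by
      simp only [smul_eq_mul]; ring
    simp only [h1]
    rw [integral_sub (hmulint ψ hψ.continuous hψc) (hψi.integrableOn.const_mul _), hz2,
      integral_const_mul, setIntegral_eq_integral_of_forall_compl_eq_zero hout]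
    ring
  refine ⟨c, ?_⟩
  have := Measure.eqOn_open_of_ae_eq (μ := volume) (f := v) (g := fun _ => c) (U := Ioo 0 l)
    ((ae_restrict_iff' measurableSet_Ioo).2 (hae.mono fun x hx hx' => sub_eq_zero.1 (hx hx')))
    isOpen_Ioo hv continuousOn_const
  exact this

/-- A continuous function in `H¹(0, l)` is a primitive of its weak derivative, up to a constant. -/
theorem HasH1Deriv.exists_eq_add_primitive {l : ℝ} (hl : 0 < l) {u w : ℝ → ℝ}
    (h : HasH1Deriv l u w) (hu : ContinuousOn u (Ioo 0 l)) :
    IntervalIntegrable w volume 0 l ∧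
      ∃ c, ∀ x ∈ Ioo 0 l, u x = c + ∫ y in (0 : ℝ)..x, w y := by
  obtain ⟨hu2, hw2, hweak⟩ := h
  have hui : IntegrableOn u (Ioo 0 l) := hu2.integrable (by norm_num)
  have hwi : IntegrableOn w (Ioo 0 l) := hw2.integrable (by norm_num)
  have hwI : IntervalIntegrable w volume 0 l := by
    rw [intervalIntegrable_iff_integrableOn_Ioo_of_le hl.le]
    exact hwi
  refine ⟨hwI, ?_⟩
  have hWc : ContinuousOn (fun x => ∫ y in (0 : ℝ)..x, w y) (Icc 0 l) := by
    have := intervalIntegral.continuousOn_primitive_interval (μ := volume) (f := w) (a := 0) (b := l)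
      (by rwa [uIcc_of_le hl.le, integrableOn_Icc_iff_integrableOn_Ioo])
    rwa [uIcc_of_le hl.le] at this
  have hWi : IntegrableOn (fun x => ∫ y in (0 : ℝ)..x, w y) (Ioo 0 l) :=
    hWc.integrableOn_Icc.mono_set Ioo_subset_Icc_self
  -- The difference of `u` and the primitive of `w` has weak derivative zero.
  obtain ⟨c, hc⟩ := eqOn_const_of_integral_mul_deriv_eq_zero hl
    (v := fun x => u x - ∫ y in (0 : ℝ)..x, w y) (hu.sub (hWc.mono Ioo_subset_Icc_self))
    (hui.sub hWi) (fun φ hφ hφc hφs => by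
      have hd : Continuous (deriv φ) := hφ.continuous_deriv (by simp)
      obtain ⟨C, hC⟩ := hφc.deriv.exists_bound_of_continuous hd
      have h1 : IntegrableOn (fun t => u t * deriv φ t) (Ioo 0 l) :=
        hui.mul_bdd hd.aestronglyMeasurable (Filter.Eventually.of_forall hC)
      have h2 : IntegrableOn (fun t => (∫ y in (0 : ℝ)..t, w y) * deriv φ t) (Ioo 0 l) :=
        hWi.mul_bdd hd.aestronglyMeasurable (Filter.Eventually.of_forall hC)
      simp only [sub_mul]
      rw [integral_sub h1 h2, hweak φ hφ hφc hφs, integral_primitive_mul_deriv hl hwI hφ hφs]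
      ring)
  exact ⟨c, fun x hx => by linarith [hc x hx]⟩

/-- The increments of the square of a continuous function in `H¹(0, l)`. -/
theorem HasH1Deriv.abs_sq_sub_sq_le {l : ℝ} (hl : 0 < l) {u w : ℝ → ℝ}
    (h : HasH1Deriv l u w) (hu : ContinuousOn u (Ioo 0 l)) {s t : ℝ} (hs : 0 < s) (hst : s ≤ t)
    (ht : t < l) : |u t ^ 2 - u s ^ 2| ≤ ∫ x in s..t, |2 * u x * w x| := by
  obtain ⟨hwI, c, hc⟩ := h.exists_eq_add_primitive hl hu
  let U : ℝ → ℝ := fun x => c + ∫ y in (0 : ℝ)..x, w y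
  have hsub : uIcc s t ⊆ Ioo 0 l := by
    rw [uIcc_of_le hst]
    exact fun x hx => ⟨hs.trans_le hx.1, hx.2.trans_lt ht⟩
  have hsub' : uIcc s t ⊆ uIcc 0 l := by
    rw [uIcc_of_le hl.le]
    exact hsub.trans Ioo_subset_Icc_self
  have hU : AbsolutelyContinuousOnInterval U s t := by
    have h1 : AbsolutelyContinuousOnInterval (fun _ : ℝ => c) s t :=
      (contDiff_const (n := 1)).contDiffOn.absolutelyContinuousOnInterval
    exact h1.add ((hwI.absolutelyContinuousOnInterval_intervalIntegral (c := 0) (by simp)).mono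
      hsub')
  have hkey := hU.integral_deriv_mul_eq_sub hU
  have hcongr : ∫ x in s..t, deriv U x * U x + U x * deriv U x
      = ∫ x in s..t, 2 * u x * w x := by
    apply intervalIntegral.integral_congr_ae
    filter_upwards [hwI.ae_hasDerivAt_integral] with x hx hxI
    have hxI := uIoc_subset_uIcc hxI
    have : HasDerivAt U (w x) x := (hx (hsub' hxI) 0 (by simp)).const_add c
    rw [this.deriv, hc x (hsub hxI)]
    ring
  rw [hcongr] at hkey
  have : u t ^ 2 - u s ^ 2 = ∫ x in s..t, 2 * u x * w x := by
    rw [hkey, hc t ⟨hs.trans_le hst, ht⟩, hc s ⟨hs, hst.trans_lt ht⟩]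
    ring
  rw [this]
  exact intervalIntegral.abs_integral_le_integral_abs hst

/-! ### Convex polygons: sides, boundary and perimeter. -/

theorem finRotate_iterate_zero {n : ℕ} (hn : 0 < n) (k : ℕ) :
    (finRotate n)^[k] ⟨0, hn⟩ = ⟨k % n, Nat.mod_lt _ hn⟩ := by
  obtain ⟨m, rfl⟩ := Nat.exists_eq_succ_of_ne_zero hn.ne'
  induction k with
  | zero => simp
  | succ k ih =>
    rw [Function.iterate_succ_apply', ih, finRotate_apply]
    apply Fin.ext
    simp [Fin.val_add]

theorem finRotate_ne_self {n : ℕ} (hn : 2 ≤ n) (i : Fin n) : finRotate n i ≠ i := by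
  obtain ⟨m, rfl⟩ : ∃ m, n = m + 2 := ⟨n - 2, by omega⟩
  rw [finRotate_apply]
  intro h
  simp at h

theorem finRotate_finRotate_ne_self {n : ℕ} (hn : 3 ≤ n) (i : Fin n) :
    finRotate n (finRotate n i) ≠ i := by
  obtain ⟨m, rfl⟩ : ∃ m, n = m + 3 := ⟨n - 3, by omega⟩
  rw [finRotate_apply, finRotate_apply, add_assoc]
  intro h
  rw [add_eq_left] at h
  have h2 := congrArg Fin.val h
  rw [Fin.val_add, Fin.val_one, Fin.val_zero, Nat.mod_eq_of_lt (by omega)] at h2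
  omega

theorem exists_convex_combination {E : Type*} [AddCommGroup E] [Module ℝ E] {a b z : E}
    (hz : z ∈ segment ℝ a b) : ∃ t : ℝ, 0 ≤ t ∧ t ≤ 1 ∧ z = (1 - t) • a + t • b := by
  obtain ⟨s, t, hs, ht, hst, rfl⟩ := hz
  exact ⟨t, ht, by linarith, by rw [← hst]; simp⟩

theorem ne_zero_iff_sq_add_sq_pos {e : Plane} : e ≠ 0 ↔ 0 < e 0 ^ 2 + e 1 ^ 2 := by
  constructor
  · intro h
    rcases (by positivity : 0 ≤ e 0 ^ 2 + e 1 ^ 2).eq_or_lt with h0 | h0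
    · exfalso
      have h3 : e 0 = 0 := by nlinarith [sq_nonneg (e 0), sq_nonneg (e 1)]
      have h4 : e 1 = 0 := by nlinarith [sq_nonneg (e 0), sq_nonneg (e 1)]
      apply h
      ext k
      fin_cases k <;> simpa
    · exact h0
  · rintro h rfl
    simp at h

namespace ConvexPolygon

variable (P : ConvexPolygon)

/-- The `i`-th side, as a segment. -/
theorem edgeSet_eq (i : Fin P.n) :
    P.poly.edgeSet ℝ i = segment ℝ (P.poly i) (P.poly (finRotate P.n i)) :=
  affineSegment_eq_segment ℝ _ _

theorem exists_third (i : Fin P.n) : ∃ j, j ≠ i ∧ j ≠ finRotate P.n i :=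
  ⟨finRotate P.n (finRotate P.n i), finRotate_finRotate_ne_self P.three_le i,
    finRotate_ne_self (by linarith [P.three_le]) _⟩

theorem poly_ne (i : Fin P.n) : P.poly i ≠ P.poly (finRotate P.n i) := by
  obtain ⟨j, hj, hj'⟩ := P.exists_third i
  intro h
  have := P.left_of i j hj hj'
  rw [← h, sub_self] at this
  simp [cross] at this

/-- The affine function whose zero set is the line through the `i`-th side, and which is
nonnegative on the polygon. -/
def sideFun (i : Fin P.n) (z : Plane) : ℝ :=
  cross (P.poly (finRotate P.n i) - P.poly i) (z - P.poly i)

theorem sideFun_combination (i : Fin P.n) (s t : ℝ) (hst : s + t = 1) (x y : Plane) :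
    P.sideFun i (s • x + t • y) = s * P.sideFun i x + t * P.sideFun i y := by
  obtain rfl : s = 1 - t := by linarith
  simp [sideFun, cross]
  ring

theorem sideFun_self (i : Fin P.n) : P.sideFun i (P.poly i) = 0 := by
  simp [sideFun, cross]

theorem sideFun_finRotate (i : Fin P.n) : P.sideFun i (P.poly (finRotate P.n i)) = 0 := by
  simp [sideFun, cross]
  ring

theorem sideFun_vertex_nonneg (i j : Fin P.n) : 0 ≤ P.sideFun i (P.poly j) := by
  by_cases h : j = i
  · rw [h, P.sideFun_self]
  by_cases h' : j = finRotate P.n i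
  · rw [h', P.sideFun_finRotate]
  exact (P.left_of i j h h').le

theorem sideFun_nonneg (i : Fin P.n) {z : Plane} (hz : z ∈ P.carrier) : 0 ≤ P.sideFun i z := by
  have : P.carrier ⊆ {z | 0 ≤ P.sideFun i z} := by
    apply convexHull_min
    · rintro _ ⟨j, rfl⟩
      exact P.sideFun_vertex_nonneg i j
    · intro x hx y hy s t hs ht hst
      change 0 ≤ P.sideFun i _
      rw [P.sideFun_combination i s t hst]
      exact add_nonneg (mul_nonneg hs hx) (mul_nonneg ht hy)
  exact this hz

theorem sideFun_eq_zero {i : Fin P.n} {z : Plane} (hz : z ∈ P.poly.edgeSet ℝ i) :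
    P.sideFun i z = 0 := by
  rw [P.edgeSet_eq] at hz
  obtain ⟨t, -, -, rfl⟩ := exists_convex_combination hz
  rw [P.sideFun_combination i _ _ (by ring), P.sideFun_self, P.sideFun_finRotate]
  ring

theorem convex_carrier : Convex ℝ P.carrier := convex_convexHull ℝ _

theorem isCompact_carrier : IsCompact P.carrier :=
  (finite_range P.poly.vertices).isCompact_convexHull ℝ

theorem vertex_mem_carrier (i : Fin P.n) : P.poly i ∈ P.carrier :=
  subset_convexHull ℝ _ (mem_range_self i)

theorem edgeSet_subset_boundary (i : Fin P.n) : P.poly.edgeSet ℝ i ⊆ P.boundary :=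
  subset_iUnion (fun i => P.poly.edgeSet ℝ i) i

theorem edgeSet_subset_carrier (i : Fin P.n) : P.poly.edgeSet ℝ i ⊆ P.carrier := by
  rw [P.edgeSet_eq]
  exact P.convex_carrier.segment_subset (P.vertex_mem_carrier _) (P.vertex_mem_carrier _)

theorem boundary_subset_carrier : P.boundary ⊆ P.carrier :=
  iUnion_subset P.edgeSet_subset_carrier

theorem isCompact_edgeSet (i : Fin P.n) : IsCompact (P.poly.edgeSet ℝ i) := by
  rw [P.edgeSet_eq, segment_eq_image_lineMap]
  exact isCompact_Icc.image AffineMap.lineMap_continuous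

theorem isCompact_boundary : IsCompact P.boundary :=
  isCompact_iUnion P.isCompact_edgeSet

theorem vertex_mem_edgeSet (i : Fin P.n) : P.poly i ∈ P.poly.edgeSet ℝ i := by
  rw [P.edgeSet_eq]
  exact left_mem_segment _ _ _

theorem finRotate_vertex_mem_edgeSet (i : Fin P.n) :
    P.poly (finRotate P.n i) ∈ P.poly.edgeSet ℝ i := by
  rw [P.edgeSet_eq]
  exact right_mem_segment _ _ _

theorem vertex_mem_boundary (i : Fin P.n) : P.poly i ∈ P.boundary :=
  P.edgeSet_subset_boundary i (P.vertex_mem_edgeSet i)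

theorem n_pos : 0 < P.n := by linarith [P.three_le]

theorem boundary_nonempty : P.boundary.Nonempty := ⟨_, P.vertex_mem_boundary ⟨0, P.n_pos⟩⟩

/-- Moving from a point of a side along the outward normal makes the side functional negative at
once, so the point leaves the polygon. -/
theorem notMem_interior_of_mem_boundary {z : Plane} (hz : z ∈ P.boundary) :
    z ∉ interior P.carrier := by
  obtain ⟨i, hi⟩ := mem_iUnion.1 hz
  intro hint
  let e := P.poly (finRotate P.n i) - P.poly i
  let d : Plane := !₂[e 1, -e 0]
  have hcont : Filter.Tendsto (fun t : ℝ => z + t • d) (𝓝[>] 0) (𝓝 z) := by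
    have : Continuous fun t : ℝ => z + t • d := by fun_prop
    have h := this.tendsto 0
    simp only [zero_smul, add_zero] at h
    exact h.mono_left nhdsWithin_le_nhds
  have hev := hcont.eventually (mem_interior_iff_mem_nhds.1 hint)
  obtain ⟨t, htP, ht⟩ := (hev.and self_mem_nhdsWithin).exists
  have h1 := P.sideFun_nonneg i htP
  have h0 := P.sideFun_eq_zero hi
  have h2 : P.sideFun i (z + t • d) = P.sideFun i z - t * (e 0 ^ 2 + e 1 ^ 2) := by
    simp [sideFun, cross, d, e]
    ring
  have he : 0 < e 0 ^ 2 + e 1 ^ 2 :=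
    ne_zero_iff_sq_add_sq_pos.1 (sub_ne_zero.2 (P.poly_ne i).symm)
  have ht : 0 < t := ht
  have := mul_pos ht he
  linarith

theorem edgeSet_inter_subset {i j : Fin P.n} (hij : i ≠ j) :
    P.poly.edgeSet ℝ i ∩ P.poly.edgeSet ℝ j ⊆ range P.poly.vertices := by
  rintro z ⟨hi, hj⟩
  have h0 := P.sideFun_eq_zero hi
  rw [P.edgeSet_eq] at hj
  obtain ⟨t, ht0, ht1, rfl⟩ := exists_convex_combination hj
  rw [P.sideFun_combination i _ _ (by ring)] at h0
  have h1 := P.sideFun_vertex_nonneg i j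
  have h2 := P.sideFun_vertex_nonneg i (finRotate P.n j)
  have h3 := mul_nonneg (sub_nonneg.2 ht1) h1
  have h4 := mul_nonneg ht0 h2
  -- One endpoint of side `j` lies strictly to the left of side `i`: the far one if `j` follows `i`,
  -- otherwise the near one. Its weight in the convex combination must vanish, which leaves the
  -- other endpoint.
  by_cases hj' : j = finRotate P.n i
  · have h5 : 0 < P.sideFun i (P.poly (finRotate P.n j)) := by
      apply P.left_of
      · rw [hj']
        exact finRotate_finRotate_ne_self P.three_le i
      · rw [← hj']
        exact finRotate_ne_self (by linarith [P.three_le]) _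
    have h6 : t = 0 := by
      have : t * P.sideFun i (P.poly (finRotate P.n j)) = 0 := by linarith
      exact (mul_eq_zero.1 this).resolve_right h5.ne'
    exact ⟨j, by simp [h6]⟩
  · have h5 : 0 < P.sideFun i (P.poly j) := P.left_of i j hij.symm hj'
    have h6 : 1 - t = 0 := by
      have : (1 - t) * P.sideFun i (P.poly j) = 0 := by linarith
      exact (mul_eq_zero.1 this).resolve_right h5.ne'
    exact ⟨finRotate P.n j, by simp [(sub_eq_zero.1 h6).symm]⟩

/-- The corner reached after `k` steps from the first one. -/
def corner (k : ℕ) : Fin P.n := (finRotate P.n)^[k] ⟨0, P.n_pos⟩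

theorem corner_succ (k : ℕ) : P.corner (k + 1) = finRotate P.n (P.corner k) :=
  Function.iterate_succ_apply' _ _ _

theorem corner_val (i : Fin P.n) : P.corner i = i := by
  rw [corner, finRotate_iterate_zero]
  apply Fin.ext
  exact Nat.mod_eq_of_lt i.2

/-- Listing the sides cyclically gives a chain in which consecutive segments share a corner. -/
theorem isPreconnected_boundary : IsPreconnected P.boundary := by
  have : P.boundary = ⋃ k : ℕ, P.poly.edgeSet ℝ (P.corner k) := by
    apply subset_antisymm
    · exact iUnion_subset fun i => by
        conv_lhs => rw [← P.corner_val i]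
        exact subset_iUnion (fun k => P.poly.edgeSet ℝ (P.corner k)) _
    · exact iUnion_subset fun k => P.edgeSet_subset_boundary _
  rw [this]
  apply IsPreconnected.iUnion_of_chain
  · intro k
    rw [P.edgeSet_eq]
    exact (convex_segment _ _).isPreconnected
  · intro k
    refine ⟨P.poly (P.corner (k + 1)), ?_, P.vertex_mem_edgeSet _⟩
    rw [P.corner_succ]
    exact P.finRotate_vertex_mem_edgeSet _

theorem dist_corner_le (i : Fin P.n) : dist (P.poly (P.corner 0)) (P.poly i) ≤ P.perimeter := by
  conv_lhs => rw [← P.corner_val i]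
  calc _ ≤ ∑ k ∈ Finset.range i, dist (P.poly (P.corner k)) (P.poly (P.corner (k + 1))) :=
        dist_le_range_sum_dist (fun k => P.poly (P.corner k)) _
    _ ≤ ∑ k ∈ Finset.range P.n, dist (P.poly (P.corner k)) (P.poly (P.corner (k + 1))) :=
        Finset.sum_le_sum_of_subset_of_nonneg (Finset.range_subset_range.2 i.2.le)
          fun _ _ _ => dist_nonneg
    _ = P.perimeter := by
        rw [Finset.sum_range]
        exact Finset.sum_congr rfl fun k _ => by rw [P.corner_succ, P.corner_val]

theorem dist_le {x y : Plane} (hx : x ∈ P.carrier) (hy : y ∈ P.carrier) :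
    dist x y ≤ 2 * P.perimeter := by
  have hsub : P.carrier ⊆ Metric.closedBall (P.poly (P.corner 0)) P.perimeter := by
    apply convexHull_min _ (convex_closedBall _ _)
    rintro _ ⟨i, rfl⟩
    rw [Metric.mem_closedBall, dist_comm]
    exact P.dist_corner_le i
  have h1 := hsub hx
  have h2 := hsub hy
  rw [Metric.mem_closedBall] at h1 h2
  linarith [dist_triangle_right x y (P.poly (P.corner 0))]

/-- A crude bound, obtained from the diameter; its purpose is a uniform positive lower bound on the
boundary lengths of the tiles. -/
theorem le_perimeter {x : Plane} {r : ℝ} (hr : 0 ≤ r) (h : Metric.closedBall x r ⊆ P.carrier) :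
    r ≤ 2 * P.perimeter := by
  have h1 : x + EuclideanSpace.single 0 r ∈ Metric.closedBall x r := by
    simp [abs_of_nonneg hr]
  have := P.dist_le (h h1) (h (Metric.mem_closedBall_self hr))
  simpa [abs_of_nonneg hr] using this

theorem measurableSet_boundary : MeasurableSet P.boundary := P.isCompact_boundary.measurableSet

theorem hausdorffMeasure_edgeSet (i : Fin P.n) :
    (Measure.hausdorffMeasure 1 : Measure Plane) (P.poly.edgeSet ℝ i)
      = ENNReal.ofReal (dist (P.poly i) (P.poly (finRotate P.n i))) := by
  rw [P.edgeSet_eq, hausdorffMeasure_segment, edist_dist]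

theorem ofReal_perimeter : ENNReal.ofReal P.perimeter
    = ∑ i, (Measure.hausdorffMeasure 1 : Measure Plane) (P.poly.edgeSet ℝ i) := by
  rw [perimeter, ENNReal.ofReal_sum_of_nonneg fun _ _ => dist_nonneg]
  exact Finset.sum_congr rfl fun i _ => (P.hausdorffMeasure_edgeSet i).symm

/-- Distinct sides meet only in corners, and finite sets are null for the length measure. -/
theorem restrict_boundary :
    (Measure.hausdorffMeasure 1 : Measure Plane).restrict P.boundary
      = Measure.sum fun i => (Measure.hausdorffMeasure 1).restrict (P.poly.edgeSet ℝ i) := by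
  have := Measure.nullSingletonClass_hausdorff Plane (d := 1) one_pos
  apply Measure.restrict_iUnion_ae
  · intro i j hij
    exact measure_mono_null (P.edgeSet_inter_subset hij) ((finite_range _).measure_zero _)
  · exact fun i => (P.isCompact_edgeSet i).measurableSet.nullMeasurableSet

theorem lintegral_boundary (φ : Plane → ℝ≥0∞) :
    ∫⁻ x in P.boundary, φ x ∂(Measure.hausdorffMeasure 1 : Measure Plane)
      = ∑ i, ∫⁻ x in P.poly.edgeSet ℝ i, φ x ∂(Measure.hausdorffMeasure 1 : Measure Plane) := by
  rw [P.restrict_boundary, lintegral_sum_measure, tsum_fintype]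

theorem hausdorffMeasure_boundary :
    (Measure.hausdorffMeasure 1 : Measure Plane) P.boundary = ENNReal.ofReal P.perimeter := by
  rw [P.ofReal_perimeter]
  simpa using P.lintegral_boundary fun _ => 1

end ConvexPolygon

/-! ### Overlapping interiors of convex sets in the plane. -/

/-- The three inequalities say that the barycentric coordinates of `y` in the triangle `v w q` are
positive; they cut out an open set contained in `C`. -/
theorem Convex.mem_interior_of_cross {C : Set Plane} (hC : Convex ℝ C) {v w q y : Plane}
    (hv : v ∈ C) (hw : w ∈ C) (hq : q ∈ C) (h1 : 0 < cross (w - v) (y - v))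
    (h2 : 0 < cross (y - v) (q - v))
    (h3 : cross (w - v) (y - v) + cross (y - v) (q - v) < cross (w - v) (q - v)) :
    y ∈ interior C := by
  have hκ : 0 < cross (w - v) (q - v) := by linarith
  have ho : IsOpen {y : Plane | 0 < cross (w - v) (y - v) ∧ 0 < cross (y - v) (q - v) ∧
      cross (w - v) (y - v) + cross (y - v) (q - v) < cross (w - v) (q - v)} := by
    have c1 : Continuous fun y : Plane => cross (w - v) (y - v) := by
      unfold cross; fun_prop
    have c2 : Continuous fun y : Plane => cross (y - v) (q - v) := by
      unfold cross; fun_prop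
    exact (isOpen_lt continuous_const c1).inter
      ((isOpen_lt continuous_const c2).inter (isOpen_lt (c1.add c2) continuous_const))
  refine interior_maximal ?_ ho ⟨h1, h2, h3⟩
  rintro x ⟨hx1, hx2, hx3⟩
  generalize hκe : cross (w - v) (q - v) = κ at *
  generalize hte : cross (w - v) (x - v) = t at *
  generalize hse : cross (x - v) (q - v) = s at *
  have hx : x = ((κ - s - t) / κ) • v + (s / κ) • w + (t / κ) • q := by
    have : κ • x = (κ - s - t) • v + s • w + t • q := by
      rw [← hκe, ← hte, ← hse]
      ext k
      fin_cases k <;> simp [cross] <;> ring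
    rw [← inv_smul_smul₀ hκ.ne' x, this]
    simp only [smul_add, smul_smul, div_eq_inv_mul]
  rw [hx]
  have := hC.sum_mem (t := Finset.univ) (w := ![(κ - s - t) / κ, s / κ, t / κ]) (z := ![v, w, q])
    (by
      intro i _
      fin_cases i
      · exact div_nonneg (by linarith) hκ.le
      · exact div_nonneg hx2.le hκ.le
      · exact div_nonneg hx1.le hκ.le)
    (by simp [Fin.sum_univ_three]; field_simp; ring)
    (by intro i _; fin_cases i <;> assumption)
  simpa [Fin.sum_univ_three] using this

/-- A convex set containing `v`, `w` and a point to the left of the line from `v` to `w` contains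
in its interior all points slightly to the left of the midpoint of `v` and `w`. -/
theorem Convex.eventually_mem_interior_of_cross_pos {C : Set Plane} (hC : Convex ℝ C)
    {v w q : Plane} (hv : v ∈ C) (hw : w ∈ C) (hq : q ∈ C) (hκ : 0 < cross (w - v) (q - v)) :
    ∀ᶠ ε : ℝ in 𝓝[>] 0,
      v + (1 / 2 : ℝ) • (w - v) + ε • (!₂[-(w - v) 1, (w - v) 0] : Plane) ∈ interior C := by
  let y : ℝ → Plane := fun ε => v + (1 / 2 : ℝ) • (w - v) + ε • !₂[-(w - v) 1, (w - v) 0]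
  have he : 0 < (w - v) 0 ^ 2 + (w - v) 1 ^ 2 := by
    rw [← ne_zero_iff_sq_add_sq_pos]
    intro h
    simp [h, cross] at hκ
  have c1 : ∀ ε, cross (w - v) (y ε - v) = ε * ((w - v) 0 ^ 2 + (w - v) 1 ^ 2) := fun ε => by
    simp [cross, y]; ring
  have c2 : Continuous fun ε => cross (y ε - v) (q - v) := by
    unfold cross; fun_prop
  have c3 : cross (y 0 - v) (q - v) = cross (w - v) (q - v) / 2 := by
    simp [cross, y]; ring
  have e1 : ∀ᶠ ε in 𝓝[>] (0 : ℝ), 0 < cross (y ε - v) (q - v) :=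
    (c2.tendsto 0).mono_left nhdsWithin_le_nhds |>.eventually (lt_mem_nhds (by rw [c3]; linarith))
  have e2 : ∀ᶠ ε in 𝓝[>] (0 : ℝ), ε * ((w - v) 0 ^ 2 + (w - v) 1 ^ 2) + cross (y ε - v) (q - v)
      < cross (w - v) (q - v) := by
    have c4 : Continuous fun ε => ε * ((w - v) 0 ^ 2 + (w - v) 1 ^ 2) + cross (y ε - v) (q - v) := by
      fun_prop
    exact (c4.tendsto 0).mono_left nhdsWithin_le_nhds |>.eventually
      (gt_mem_nhds (by rw [c3, zero_mul, zero_add]; linarith))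
  filter_upwards [e1, e2, self_mem_nhdsWithin] with ε h1 h2 h3
  exact hC.mem_interior_of_cross hv hw hq (by rw [c1]; exact mul_pos h3 he) h1 (by rwa [c1])

/-- The sign condition puts `q` and `r` on the same side of the line through `v` and `w`. Both
interiors then contain the points just off the midpoint of `v` and `w` on that side. -/
theorem interior_inter_nonempty_of_cross {C D : Set Plane} (hC : Convex ℝ C) (hD : Convex ℝ D)
    {v w q r : Plane} (hvC : v ∈ C) (hwC : w ∈ C) (hvD : v ∈ D) (hwD : w ∈ D) (hq : q ∈ C)
    (hr : r ∈ D) (h : 0 < cross (w - v) (q - v) * cross (w - v) (r - v)) :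
    (interior C ∩ interior D).Nonempty := by
  have hswap : ∀ x : Plane, cross (v - w) (x - w) = - cross (w - v) (x - v) := fun x => by
    simp [cross]; ring
  rcases pos_and_pos_or_neg_and_neg_of_mul_pos h with ⟨h1, h2⟩ | ⟨h1, h2⟩
  · obtain ⟨ε, h3, h4⟩ := ((hC.eventually_mem_interior_of_cross_pos hvC hwC hq h1).and
      (hD.eventually_mem_interior_of_cross_pos hvD hwD hr h2)).exists
    exact ⟨_, h3, h4⟩
  · obtain ⟨ε, h3, h4⟩ := ((hC.eventually_mem_interior_of_cross_pos hwC hvC hq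
      (by rw [hswap]; linarith)).and
      (hD.eventually_mem_interior_of_cross_pos hwD hvD hr (by rw [hswap]; linarith))).exists
    exact ⟨_, h3, h4⟩

theorem exists_cross_ne_zero_of_mem_nhds {C : Set Plane} {x v e : Plane} (hC : C ∈ 𝓝 x)
    (he : e ≠ 0) : ∃ q ∈ C, cross e (q - v) ≠ 0 := by
  by_cases h0 : cross e (x - v) = 0
  · have hc : Continuous fun ε : ℝ => x + ε • (!₂[-e 1, e 0] : Plane) := by fun_prop
    have h := hc.tendsto 0
    simp only [zero_smul, add_zero] at h
    obtain ⟨ε, h1, h2⟩ := (((h.mono_left nhdsWithin_le_nhds).eventually hC).and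
      (self_mem_nhdsWithin : Ioi (0 : ℝ) ∈ 𝓝[>] 0)).exists
    refine ⟨_, h1, ?_⟩
    have : cross e (x + ε • (!₂[-e 1, e 0] : Plane) - v) =
        cross e (x - v) + ε * (e 0 ^ 2 + e 1 ^ 2) := by
      simp [cross]; ring
    rw [this, h0, zero_add]
    exact (mul_pos h2 (ne_zero_iff_sq_add_sq_pos.1 he)).ne'
  · exact ⟨x, mem_of_mem_nhds hC, h0⟩

/-! ### Local structure of the tiling: packing, local finiteness, vertices. -/

namespace PolygonalTiling

variable {T : PolygonalTiling} {h H M : ℝ}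

theorem disjoint_interior {n m : ℕ} (hnm : n ≠ m) :
    Disjoint (interior (T.tile n).carrier) (interior (T.tile m).carrier) := by
  rw [Set.disjoint_left]
  intro z hn hm
  exact (T.tile n).notMem_interior_of_mem_boundary
    (T.inter_subset n m hnm ⟨interior_subset hn, interior_subset hm⟩) hn

theorem exists_mem_carrier (z : Plane) : ∃ n, z ∈ (T.tile n).carrier := by
  have : z ∈ ⋃ n, (T.tile n).carrier := T.cover ▸ mem_univ z
  exact mem_iUnion.1 this

theorem boundary_subset_graph (n : ℕ) : (T.tile n).boundary ⊆ T.graph :=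
  subset_iUnion (fun n => (T.tile n).boundary) n

theorem measurableSet_graph : MeasurableSet T.graph :=
  MeasurableSet.iUnion fun n => (T.tile n).measurableSet_boundary

namespace Admissible

variable (hT : T.Admissible h H M)
include hT

theorem exists_closedBall_subset (n : ℕ) :
    ∃ x, Metric.closedBall x h ⊆ (T.tile n).carrier := by
  obtain ⟨x, r, ⟨-, hsub, -⟩, hr, -⟩ := hT.incircle n
  exact ⟨x, (Metric.closedBall_subset_closedBall hr).trans hsub⟩

/-- The centre of a ball of radius `h` in the `n`-th tile. -/
noncomputable def center (n : ℕ) : Plane := (hT.exists_closedBall_subset n).choose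

theorem closedBall_center_subset (n : ℕ) :
    Metric.closedBall (hT.center n) h ⊆ (T.tile n).carrier :=
  (hT.exists_closedBall_subset n).choose_spec

theorem ball_center_subset (n : ℕ) :
    Metric.ball (hT.center n) h ⊆ interior (T.tile n).carrier :=
  interior_maximal (Metric.ball_subset_closedBall.trans (hT.closedBall_center_subset n))
    Metric.isOpen_ball

theorem pairwise_disjoint_ball :
    Pairwise (Function.onFun Disjoint fun n => Metric.ball (hT.center n) h) := fun _ _ hnm =>
  (disjoint_interior hnm).mono (hT.ball_center_subset _) (hT.ball_center_subset _)

theorem le_two_mul_perimeter (hh : 0 < h) (n : ℕ) : h ≤ 2 * (T.tile n).perimeter :=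
  (T.tile n).le_perimeter hh.le (hT.closedBall_center_subset n)

theorem dist_le {n : ℕ} {x y : Plane} (hx : x ∈ (T.tile n).carrier) (hy : y ∈ (T.tile n).carrier) :
    dist x y ≤ 2 * M :=
  ((T.tile n).dist_le hx hy).trans (by linarith [hT.perimeter_le n])

/-- A packing bound: the disjoint balls of radius `h` inside these tiles all lie in the enlarged
ball, as tiles have diameter at most `2 * M`. -/
theorem card_mul_volume_le {z : Plane} {R : ℝ} {s : Finset ℕ}
    (hs : ∀ n ∈ s, ((T.tile n).carrier ∩ Metric.closedBall z R).Nonempty) :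
    s.card * volume (Metric.ball (0 : Plane) h) ≤ volume (Metric.closedBall z (R + 2 * M)) := by
  calc _ = ∑ n ∈ s, volume (Metric.ball (hT.center n) h) := by
        simp [Measure.addHaar_ball_center]
    _ = volume (⋃ n ∈ s, Metric.ball (hT.center n) h) :=
        (measure_biUnion_finset (hT.pairwise_disjoint_ball.set_pairwise _)
          fun _ _ => measurableSet_ball).symm
    _ ≤ _ := by
        apply measure_mono
        refine iUnion₂_subset fun n hn y hy => ?_
        obtain ⟨x, hx, hxz⟩ := hs n hn
        have h1 := hT.dist_le (interior_subset (hT.ball_center_subset n hy)) hx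
        rw [Metric.mem_closedBall] at hxz ⊢
        linarith [dist_triangle y x z]

theorem finite_inter_closedBall (hh : 0 < h) (z : Plane) (R : ℝ) :
    {n | ((T.tile n).carrier ∩ Metric.closedBall z R).Nonempty}.Finite := by
  by_contra hinf
  have hinf : Set.Infinite _ := hinf
  have hv := Metric.measure_ball_pos volume (0 : Plane) hh
  have hV : volume (Metric.closedBall z (R + 2 * M)) ≠ ⊤ := measure_closedBall_lt_top.ne
  obtain ⟨N, hN⟩ := ENNReal.exists_nat_mul_gt hv.ne' hV
  obtain ⟨s, hs, hcard⟩ := hinf.exists_subset_card_eq N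
  have := hT.card_mul_volume_le (z := z) (R := R) (s := s) fun n hn => hs hn
  rw [hcard] at this
  exact absurd hN this.not_gt

theorem locallyFinite (hh : 0 < h) : LocallyFinite fun n => (T.tile n).carrier := fun z =>
  ⟨Metric.closedBall z 1, Metric.closedBall_mem_nhds z one_pos, hT.finite_inter_closedBall hh z 1⟩

theorem exists_nhds_forall_mem (hh : 0 < h) (z : Plane) :
    ∃ N ∈ 𝓝 z, ∀ n, ((T.tile n).carrier ∩ N).Nonempty → z ∈ (T.tile n).carrier := by
  refine ⟨_, (hT.locallyFinite hh).iInter_compl_mem_nhds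
    (fun n => (T.tile n).isCompact_carrier.isClosed) z, ?_⟩
  rintro n ⟨y, hyn, hy⟩
  by_contra hz
  exact mem_iInter₂.1 hy n hz hyn

/-- By local finiteness, a small neighbourhood of `z` meets only tiles that contain `z`. -/
theorem mem_vertices_iff (hh : 0 < h) {z : Plane} :
    z ∈ T.vertices ↔ z ∈ T.graph ∧ 3 ≤ {n | z ∈ (T.tile n).carrier}.encard := by
  constructor
  · rintro ⟨hz, hv⟩
    obtain ⟨N, hN, hN'⟩ := hT.exists_nhds_forall_mem hh z
    exact ⟨hz, (hv N hN).trans (encard_le_encard hN')⟩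
  · rintro ⟨hz, hv⟩
    exact ⟨hz, fun N hN => hv.trans (encard_le_encard fun n hn => ⟨z, hn, mem_of_mem_nhds hN⟩)⟩

/-- If three tiles shared two points, two of the tiles would have points strictly on the same side
of the line through them, so their interiors would overlap. -/
theorem subsingleton_inter (hh : 0 < h) {a b c : ℕ} (hab : a ≠ b) (hac : a ≠ c) (hbc : b ≠ c) :
    ((T.tile a).carrier ∩ (T.tile b).carrier ∩ (T.tile c).carrier).Subsingleton := by
  rintro v ⟨⟨hva, hvb⟩, hvc⟩ w ⟨⟨hwa, hwb⟩, hwc⟩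
  by_contra hvw
  have he : w - v ≠ 0 := sub_ne_zero.2 (Ne.symm hvw)
  have hq : ∀ n, ∃ q ∈ (T.tile n).carrier, cross (w - v) (q - v) ≠ 0 := fun n =>
    exists_cross_ne_zero_of_mem_nhds (Filter.mem_of_superset
      (Metric.closedBall_mem_nhds (hT.center n) hh) (hT.closedBall_center_subset n)) he
  have key : ∀ {n m : ℕ} {q r : Plane}, n ≠ m → v ∈ (T.tile n).carrier → w ∈ (T.tile n).carrier →
      v ∈ (T.tile m).carrier → w ∈ (T.tile m).carrier → q ∈ (T.tile n).carrier →
      r ∈ (T.tile m).carrier → ¬ 0 < cross (w - v) (q - v) * cross (w - v) (r - v) := by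
    intro n m q r hnm h1 h2 h3 h4 h5 h6 h7
    obtain ⟨y, hy1, hy2⟩ := interior_inter_nonempty_of_cross (T.tile n).convex_carrier
      (T.tile m).convex_carrier h1 h2 h3 h4 h5 h6 h7
    exact Set.disjoint_left.1 (disjoint_interior hnm) hy1 hy2
  obtain ⟨p, hp, hp0⟩ := hq a
  obtain ⟨q, hq', hq0⟩ := hq b
  obtain ⟨r, hr, hr0⟩ := hq c
  have h1 := key hab hva hwa hvb hwb hp hq'
  have h2 := key hac hva hwa hvc hwc hp hr
  have h3 := key hbc hvb hwb hvc hwc hq' hr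
  rcases hp0.lt_or_gt with h4 | h4 <;> rcases hq0.lt_or_gt with h5 | h5 <;>
    rcases hr0.lt_or_gt with h6 | h6 <;>
    first
    | exact h1 (mul_pos_of_neg_of_neg h4 h5)
    | exact h2 (mul_pos_of_neg_of_neg h4 h6)
    | exact h3 (mul_pos_of_neg_of_neg h5 h6)
    | exact h1 (mul_pos h4 h5)
    | exact h2 (mul_pos h4 h6)
    | exact h3 (mul_pos h5 h6)

/-- A vertex is the only common point of some triple of distinct tiles, and there are countably many
triples. -/
theorem countable_vertices (hh : 0 < h) : T.vertices.Countable := by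
  have hsub : T.vertices ⊆ ⋃ p : {p : ℕ × ℕ × ℕ // p.1 ≠ p.2.1 ∧ p.1 ≠ p.2.2 ∧ p.2.1 ≠ p.2.2},
      (T.tile p.1.1).carrier ∩ (T.tile p.1.2.1).carrier ∩ (T.tile p.1.2.2).carrier := by
    intro z hz
    obtain ⟨t, ht, ht3⟩ := exists_subset_encard_eq ((hT.mem_vertices_iff hh).1 hz).2
    obtain ⟨a, b, c, hab, hac, hbc, rfl⟩ := encard_eq_three.1 ht3
    exact mem_iUnion.2 ⟨⟨(a, b, c), hab, hac, hbc⟩, ⟨ht (by simp), ht (by simp)⟩, ht (by simp)⟩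
  exact (countable_iUnion fun p =>
    (hT.subsingleton_inter hh p.2.1 p.2.2.1 p.2.2.2).countable).mono hsub

/-- The corners of the tiles are vertices of the one-skeleton. -/
theorem corner_mem_vertices (hh : 0 < h) (n : ℕ) (i : Fin (T.tile n).n) :
    (T.tile n).poly i ∈ T.vertices := by
  rw [hT.mem_vertices_iff hh]
  refine ⟨boundary_subset_graph n ((T.tile n).vertex_mem_boundary i), ?_⟩
  by_contra hlt
  -- If the corner were not a vertex, at most one tile besides the `n`-th could contain it.
  have hle : ∀ m₁ m₂, (T.tile n).poly i ∈ (T.tile m₁).carrier → (T.tile n).poly i ∈ (T.tile m₂).carrier →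
      m₁ ≠ n → m₂ ≠ n → m₁ = m₂ := by
    intro m₁ m₂ h1 h2 h3 h4
    by_contra h5
    apply hlt
    rw [← encard_eq_three.2 ⟨n, m₁, m₂, h3.symm, h4.symm, h5, rfl⟩]
    apply encard_le_encard
    rintro m (hm | hm | hm) <;> change (T.tile n).poly i ∈ (T.tile m).carrier <;> rw [hm]
    exacts [(T.tile n).vertex_mem_carrier i, h1, h2]
  obtain ⟨j, hj⟩ := (finRotate (T.tile n).n).surjective i
  set z := (T.tile n).poly i with hz
  set e := (T.tile n).poly (finRotate (T.tile n).n i) - z with he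
  set f := (T.tile n).poly j - z with hf
  have hκ : 0 < cross e f := by
    apply (T.tile n).left_of i j
    · rw [← hj]
      exact (finRotate_ne_self (by linarith [(T.tile n).three_le]) j).symm
    · rw [← hj]
      exact (finRotate_finRotate_ne_self (T.tile n).three_le j).symm
  have hi' : ∀ a b : ℝ, (T.tile n).sideFun i (z + (a • e + b • f)) = b * cross e f := fun a b => by
    simp [ConvexPolygon.sideFun, cross, he, hf, hz]; ring
  have hj' : ∀ a b : ℝ, (T.tile n).sideFun j (z + (a • e + b • f)) = a * cross e f := fun a b => by
    simp only [ConvexPolygon.sideFun, hj]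
    simp [cross, he, hf, hz]; ring
  have hout : ∀ a b : ℝ, a < 0 ∨ b < 0 → z + (a • e + b • f) ∉ (T.tile n).carrier := by
    rintro a b (hab | hab) hmem
    · have := (T.tile n).sideFun_nonneg j hmem
      rw [hj'] at this
      exact absurd this (mul_neg_of_neg_of_pos hab hκ).not_ge
    · have := (T.tile n).sideFun_nonneg i hmem
      rw [hi'] at this
      exact absurd this (mul_neg_of_neg_of_pos hab hκ).not_ge
  obtain ⟨N, hN, hN'⟩ := hT.exists_nhds_forall_mem hh z
  have hev : ∀ a b : ℝ, ∀ᶠ ε : ℝ in 𝓝[>] 0, z + ((ε * a) • e + (ε * b) • f) ∈ N := by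
    intro a b
    have hc : Continuous fun ε : ℝ => z + ((ε * a) • e + (ε * b) • f) := by fun_prop
    have h1 := hc.tendsto 0
    simp only [zero_mul, zero_smul, add_zero] at h1
    exact (h1.mono_left nhdsWithin_le_nhds).eventually hN
  obtain ⟨ε, ⟨⟨h1, h2⟩, h3⟩, hε⟩ := ((((hev (-1) 2).and (hev 2 (-1))).and (hev (-1) (-1))).and
    (self_mem_nhdsWithin : Ioi (0 : ℝ) ∈ 𝓝[>] 0)).exists
  have hε : 0 < ε := hε
  -- In the coordinates given by the two sides at `z`, the tile lies in the closed first quadrant;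
  -- nearby points outside the quadrant belong to other tiles through `z`.
  have hex : ∀ a b : ℝ, (a < 0 ∨ b < 0) → z + ((ε * a) • e + (ε * b) • f) ∈ N →
      ∃ m, m ≠ n ∧ z ∈ (T.tile m).carrier ∧
        z + ((ε * a) • e + (ε * b) • f) ∈ (T.tile m).carrier := by
    intro a b hab hmem
    obtain ⟨m, hm⟩ := T.exists_mem_carrier (z + ((ε * a) • e + (ε * b) • f))
    refine ⟨m, ?_, hN' m ⟨_, hm, hmem⟩, hm⟩
    rintro rfl
    refine hout _ _ (hab.imp ?_ ?_) hm <;> exact mul_neg_of_pos_of_neg hε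
  -- These three directions sum to zero. A single tile `m` would contain `z` displaced in each of
  -- them, while `z` lies on a side of `m`. The side functional of `m` would then vanish in all
  -- three directions, hence identically, and that side would be degenerate.
  obtain ⟨m, hmn, hzm, hm1⟩ := hex (-1) 2 (by norm_num) h1
  obtain ⟨m₂, hmn2, hzm2, hm2⟩ := hex 2 (-1) (by norm_num) h2
  obtain ⟨m₃, hmn3, hzm3, hm3⟩ := hex (-1) (-1) (by norm_num) h3
  obtain rfl := hle m m₂ hzm hzm2 hmn hmn2
  obtain rfl := hle m m₃ hzm hzm3 hmn hmn3
  obtain ⟨k, hk⟩ := mem_iUnion.1 (T.inter_subset m n hmn ⟨hzm, (T.tile n).vertex_mem_carrier i⟩)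
  have hk0 := (T.tile m).sideFun_eq_zero hk
  set E := (T.tile m).poly (finRotate (T.tile m).n k) - (T.tile m).poly k with hE
  have hlin : ∀ a b : ℝ, (T.tile m).sideFun k (z + ((ε * a) • e + (ε * b) • f))
      = (T.tile m).sideFun k z + ε * (a * cross E e + b * cross E f) := fun a b => by
    simp [ConvexPolygon.sideFun, cross, hE]; ring
  have g1 := (T.tile m).sideFun_nonneg k hm1
  have g2 := (T.tile m).sideFun_nonneg k hm2
  have g3 := (T.tile m).sideFun_nonneg k hm3
  rw [hlin, hk0, zero_add] at g1 g2 g3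
  have g1 := nonneg_of_mul_nonneg_right g1 hε
  have g2 := nonneg_of_mul_nonneg_right g2 hε
  have g3 := nonneg_of_mul_nonneg_right g3 hε
  have g4 : cross E e = 0 := by linarith
  have g5 : cross E f = 0 := by linarith
  have g6 : E 0 * cross e f = 0 := by
    have : E 0 * cross e f = e 0 * cross E f - f 0 * cross E e := by
      simp only [cross]; ring
    rw [this, g4, g5]; ring
  have g7 : E 1 * cross e f = 0 := by
    have : E 1 * cross e f = e 1 * cross E f - f 1 * cross E e := by
      simp only [cross]; ring
    rw [this, g4, g5]; ring
  have g8 := (mul_eq_zero.1 g6).resolve_right hκ.ne'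
  have g9 := (mul_eq_zero.1 g7).resolve_right hκ.ne'
  apply (T.tile m).poly_ne k
  have : E = 0 := by
    ext l
    fin_cases l <;> simpa
  exact (sub_eq_zero.1 this).symm

end Admissible

end PolygonalTiling

/-! ### Arclength parametrization and the length measure. -/

theorem isometry_arcParam {a b : Plane} (hab : a ≠ b) : Isometry (arcParam a b) := by
  refine Isometry.of_dist_eq fun s t => ?_
  have h : dist a b ≠ 0 := dist_ne_zero.2 hab
  rw [arcParam, arcParam, dist_lineMap_lineMap, Real.dist_eq, Real.dist_eq, ← sub_div, abs_div,
    abs_of_pos (dist_pos.2 hab), div_mul_cancel₀ _ h]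

theorem image_arcParam_Icc {a b : Plane} (hab : a ≠ b) :
    arcParam a b '' Icc 0 (dist a b) = segment ℝ a b := by
  have h : 0 < dist a b := dist_pos.2 hab
  rw [segment_eq_image_lineMap]
  ext z
  constructor
  · rintro ⟨t, ht, rfl⟩
    exact ⟨t / dist a b, ⟨div_nonneg ht.1 h.le, (div_le_one h).2 ht.2⟩, rfl⟩
  · rintro ⟨t, ht, rfl⟩
    refine ⟨t * dist a b, ⟨mul_nonneg ht.1 h.le, mul_le_of_le_one_left h.le ht.2⟩, ?_⟩
    rw [arcParam, mul_div_cancel_right₀ _ h.ne']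

/-- Relates the parametrization of an edge, in either direction, to that of a side containing it. -/
theorem arcParam_arcParam {p q : Plane} (hpq : p ≠ q) {a b : ℝ} (hab : a ≠ b) (t : ℝ) :
    arcParam (arcParam p q a) (arcParam p q b) t = arcParam p q (a + t / |b - a| * (b - a)) := by
  have hL : dist p q ≠ 0 := dist_ne_zero.2 hpq
  have hd : dist (arcParam p q a) (arcParam p q b) = |b - a| := by
    rw [(isometry_arcParam hpq).dist_eq, Real.dist_eq, abs_sub_comm]
  have hba : |b - a| ≠ 0 := abs_ne_zero.2 (sub_ne_zero.2 hab.symm)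
  rw [arcParam, hd, arcParam, arcParam, arcParam]
  generalize |b - a| = c at *
  ext k
  simp [AffineMap.lineMap_apply]
  field_simp
  ring

theorem Isometry.map_restrict_volume {γ : ℝ → Plane} (hγ : Isometry γ) (S : Set ℝ) :
    Measure.map γ (volume.restrict S) = (μH[1] : Measure Plane).restrict (γ '' S) := by
  have he : MeasurableEmbedding γ := hγ.isClosedEmbedding.measurableEmbedding
  have h := hγ.map_hausdorffMeasure (d := 1) (Or.inl zero_le_one)
  rw [hausdorffMeasure_real] at h
  rw [← Measure.restrict_restrict_of_subset (image_subset_range γ S), ← h, he.restrict_map,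
    preimage_image_eq _ hγ.injective]

theorem Isometry.lintegral_image {γ : ℝ → Plane} (hγ : Isometry γ) (S : Set ℝ) (φ : Plane → ℝ≥0∞) :
    ∫⁻ x in γ '' S, φ x ∂(μH[1] : Measure Plane) = ∫⁻ t in S, φ (γ t) := by
  rw [← hγ.map_restrict_volume, hγ.isClosedEmbedding.measurableEmbedding.lintegral_map]

/-! ### Multiplicity of the boundaries and variation of `f²` along them. -/

namespace PolygonalTiling

variable {T : PolygonalTiling} {h H M : ℝ}

namespace Admissible

variable (hT : T.Admissible h H M)
include hT

theorem card_le (hh : 0 < h) {z : Plane} {s : Finset ℕ} (hs : ∀ n ∈ s, z ∈ (T.tile n).carrier) :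
    (s.card : ℝ≥0∞) ≤
      volume (Metric.closedBall (0 : Plane) (2 * M)) / volume (Metric.ball (0 : Plane) h) := by
  rw [ENNReal.le_div_iff_mul_le (Or.inl (Metric.measure_ball_pos _ _ hh).ne')
    (Or.inl measure_ball_lt_top.ne)]
  have := hT.card_mul_volume_le (z := z) (R := 0) (s := s)
    fun n hn => ⟨z, hs n hn, Metric.mem_closedBall_self le_rfl⟩
  rwa [zero_add, Measure.addHaar_closedBall_center] at this

/-- The boundaries of the tiles cover the one-skeleton with bounded multiplicity. -/
theorem tsum_lintegral_boundary_le (hh : 0 < h) (φ : Plane → ℝ≥0∞) :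
    ∑' n, ∫⁻ x in (T.tile n).boundary, φ x ∂(μH[1] : Measure Plane) ≤
      volume (Metric.closedBall (0 : Plane) (2 * M)) / volume (Metric.ball (0 : Plane) h) *
        ∫⁻ x, φ x ∂T.lengthMeasure := by
  set K := volume (Metric.closedBall (0 : Plane) (2 * M)) / volume (Metric.ball (0 : Plane) h)
  rw [← lintegral_sum_measure, ← smul_eq_mul, ← lintegral_smul_measure]
  refine lintegral_mono' ?_ le_rfl
  -- Comparing measures instead of integrals keeps `φ` free of measurability hypotheses.
  refine Measure.le_iff.2 fun A hA => ?_
  rw [Measure.sum_apply _ hA, Measure.smul_apply, smul_eq_mul, lengthMeasure,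
    Measure.restrict_apply hA]
  calc ∑' n, (μH[1] : Measure Plane).restrict (T.tile n).boundary A
      = ∑' n, ∫⁻ x in A, (T.tile n).boundary.indicator 1 x ∂(μH[1] : Measure Plane) := by
        refine tsum_congr fun n => ?_
        rw [lintegral_indicator_one (T.tile n).measurableSet_boundary,
          Measure.restrict_apply hA, Measure.restrict_apply (T.tile n).measurableSet_boundary,
          inter_comm]
    _ = ∫⁻ x in A, ∑' n, (T.tile n).boundary.indicator 1 x ∂(μH[1] : Measure Plane) :=
        (lintegral_tsum fun n =>
          (measurable_one.indicator (T.tile n).measurableSet_boundary).aemeasurable).symm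
    _ ≤ ∫⁻ x in A, T.graph.indicator (fun _ => K) x ∂(μH[1] : Measure Plane) := by
        refine lintegral_mono fun x => ?_
        by_cases hx : x ∈ T.graph
        · rw [indicator_of_mem hx, ENNReal.tsum_eq_iSup_sum]
          refine iSup_le fun s => ?_
          classical
          calc ∑ n ∈ s, (T.tile n).boundary.indicator (1 : Plane → ℝ≥0∞) x
              = ((s.filter fun n => x ∈ (T.tile n).boundary).card : ℝ≥0∞) := by
                simp [Set.indicator_apply]
            _ ≤ K := hT.card_le hh (z := x) fun n hn =>
                (T.tile n).boundary_subset_carrier (Finset.mem_filter.1 hn).2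
        · have : ∀ n, (T.tile n).boundary.indicator (1 : Plane → ℝ≥0∞) x = 0 := fun n =>
            indicator_of_notMem (fun hn => hx (boundary_subset_graph n hn)) _
          simp [this]
    _ = K * μH[1] (A ∩ T.graph) := by
        rw [lintegral_indicator_const measurableSet_graph, Measure.restrict_apply
          measurableSet_graph, inter_comm]

theorem isClosed_graph (hh : 0 < h) : IsClosed T.graph :=
  ((hT.locallyFinite hh).subset fun n => (T.tile n).boundary_subset_carrier).isClosed_iUnion
    fun n => (T.tile n).isCompact_boundary.isClosed

/-- A neighbourhood meeting fewer than three tiles is also a neighbourhood of all points near `v`.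
-/
theorem isClosed_vertices (hh : 0 < h) : IsClosed T.vertices := by
  have : T.vertices = T.graph ∩
      {v | ∀ N ∈ 𝓝 v, 3 ≤ {n | ((T.tile n).carrier ∩ N).Nonempty}.encard} := rfl
  rw [this]
  refine (hT.isClosed_graph hh).inter (isOpen_compl_iff.1 (isOpen_iff_mem_nhds.2 fun v hv => ?_))
  have hv : ¬ ∀ N ∈ 𝓝 v, 3 ≤ {n | ((T.tile n).carrier ∩ N).Nonempty}.encard := hv
  push Not at hv
  obtain ⟨N, hN, hlt⟩ := hv
  filter_upwards [eventually_mem_nhds_iff.2 hN] with w hw hw'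
  exact absurd (hw' N hw) hlt.not_ge

/-- The increments of `f²` along a side of a tile are bounded by the integral of `|2 f f'|`. -/
theorem abs_sq_sub_sq_le (hh : 0 < h) {f f' : Plane → ℝ} (hf : ContinuousOn f T.graph)
    (hf' : T.IsDeriv f f') (hi : Integrable (fun x => 2 * f x * f' x) T.lengthMeasure)
    (n : ℕ) {p q : Plane} (hpq : p ≠ q) (hp : p ∈ T.vertices) (hq : q ∈ T.vertices)
    (hsub : segment ℝ p q ⊆ (T.tile n).boundary) :
    IntegrableOn (fun t => |2 * f (arcParam p q t) * f' (arcParam p q t)|) (Icc 0 (dist p q)) ∧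
    ∀ s t, 0 ≤ s → s ≤ t → t ≤ dist p q →
      |f (arcParam p q t) ^ 2 - f (arcParam p q s) ^ 2| ≤
        ∫ x in s..t, |2 * f (arcParam p q x) * f' (arcParam p q x)| := by
  have hγ := isometry_arcParam hpq
  have hL : 0 < dist p q := dist_pos.2 hpq
  have himg := image_arcParam_Icc hpq
  have hγ0 : arcParam p q 0 = p := by simp [arcParam]
  have hγL : arcParam p q (dist p q) = q := by simp [arcParam, hL.ne']
  have harc : ∀ a b : ℝ, a ≠ b → ∀ t, arcParam (arcParam p q a) (arcParam p q b) t =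
      arcParam p q (a + t / |b - a| * (b - a)) := fun a b hab t => arcParam_arcParam hpq hab t
  generalize arcParam p q = γ at *
  have hsegG : segment ℝ p q ⊆ T.graph := hsub.trans (boundary_subset_graph n)
  have hγG : ∀ t ∈ Icc 0 (dist p q), γ t ∈ T.graph := fun t ht =>
    hsegG (himg ▸ mem_image_of_mem γ ht)
  have hfγ : ContinuousOn (fun t => f (γ t)) (Icc 0 (dist p q)) :=
    hf.comp hγ.continuous.continuousOn hγG
  have hint : IntegrableOn (fun t => |2 * f (γ t) * f' (γ t)|) (Icc 0 (dist p q)) := by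
    have h1 : Integrable (fun x => |2 * f x * f' x|)
        ((μH[1] : Measure Plane).restrict (segment ℝ p q)) :=
      hi.abs.mono_measure (Measure.restrict_mono hsegG le_rfl)
    rw [← himg, ← hγ.map_restrict_volume,
      hγ.isClosedEmbedding.measurableEmbedding.integrable_map_iff] at h1
    exact h1
  refine ⟨hint, fun s t hs hst ht => ?_⟩
  refine abs_sub_le_integral_of_locally (F := fun t => f (γ t) ^ 2) (hfγ.pow 2) hint
    ((hT.countable_vertices hh).preimage hγ.injective) (fun x hx hxV => ?_) hs hst ht
  have hVc : IsClosed (γ ⁻¹' T.vertices) := (hT.isClosed_vertices hh).preimage hγ.continuous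
  -- The nearest vertices before and after `x` on the side; they exist because the vertex set is
  -- closed and contains both ends of the side. They bound an edge of `G`.
  obtain ⟨a, ⟨haI, haV⟩, hamax⟩ := (isCompact_Icc.inter_right hVc).exists_isGreatest
    ⟨0, ⟨le_rfl, hx.1.le⟩, show γ 0 ∈ T.vertices by rwa [hγ0]⟩
  obtain ⟨b, ⟨hbI, hbV⟩, hbmin⟩ := (isCompact_Icc.inter_right hVc).exists_isLeast
    ⟨dist p q, ⟨hx.2.le, le_rfl⟩, show γ (dist p q) ∈ T.vertices by rwa [hγL]⟩
  have hax : a < x := lt_of_le_of_ne haI.2 fun h => hxV (h ▸ haV)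
  have hxb : x < b := lt_of_le_of_ne hbI.1 fun h => hxV (h ▸ hbV)
  have hab : a < b := hax.trans hxb
  have hab' : Icc a b ⊆ Icc 0 (dist p q) := Icc_subset_Icc haI.1 hbI.2
  have hne : γ a ≠ γ b := hγ.injective.ne hab.ne
  have hd : dist (γ a) (γ b) = b - a := by
    rw [hγ.dist_eq, Real.dist_eq, abs_sub_comm, abs_of_pos (sub_pos.2 hab)]
  have hfwd : ∀ t, arcParam (γ a) (γ b) t = γ (a + t) := fun t => by
    rw [harc a b hab.ne, abs_of_pos (sub_pos.2 hab), div_mul_cancel₀ _ (sub_pos.2 hab).ne']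
  have hbwd : ∀ t, arcParam (γ b) (γ a) t = γ (b - t) := fun t => by
    rw [harc b a hab.ne', abs_of_neg (sub_neg.2 hab), div_neg, neg_mul,
      div_mul_cancel₀ _ (sub_neg.2 hab).ne, ← sub_eq_add_neg]
  have hseg : segment ℝ (γ a) (γ b) = γ '' Icc a b := by
    rw [← image_arcParam_Icc hne, hd]
    ext z
    constructor
    · rintro ⟨t, ht, rfl⟩
      exact ⟨a + t, ⟨by linarith [ht.1], by linarith [ht.2]⟩, (hfwd t).symm⟩
    · rintro ⟨t, ht, rfl⟩
      exact ⟨t - a, ⟨by linarith [ht.1], by linarith [ht.2]⟩, by rw [hfwd, add_sub_cancel]⟩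
  have hedge : T.IsEdge (γ a) (γ b) := by
    refine ⟨hne, ?_, ?_⟩
    · refine (openSegment_subset_segment ℝ _ _).trans ?_
      rw [hseg]
      rintro _ ⟨y, hy, rfl⟩
      exact hγG y (hab' hy)
    · rw [hseg]
      apply subset_antisymm
      · rintro _ ⟨⟨y, hy, rfl⟩, hyV⟩
        rcases le_total y x with hyx | hyx
        · left
          rw [le_antisymm (hamax ⟨⟨haI.1.trans hy.1, hyx⟩, hyV⟩) hy.1]
        · right
          rw [le_antisymm hy.2 (hbmin ⟨⟨hyx, hy.2.trans hbI.2⟩, hyV⟩)]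
          rfl
      · rintro _ (rfl | rfl)
        exacts [⟨⟨a, ⟨le_rfl, hab.le⟩, rfl⟩, haV⟩, ⟨⟨b, ⟨hab.le, le_rfl⟩, rfl⟩, hbV⟩]
  refine ⟨a, b, ⟨hax, hxb⟩, Ioo_subset_Icc_self.trans hab', fun s hs t ht hst => ?_⟩
  -- `IsDeriv` fixes only one of the two directions of the edge; the backward one is handled by the
  -- substitution `x ↦ b - x`.
  rcases hf' _ _ hedge with h1 | h1
  · rw [hd] at h1
    have hc : ContinuousOn (f ∘ arcParam (γ a) (γ b)) (Ioo 0 (b - a)) := by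
      simp only [Function.comp_def, hfwd]
      exact hfγ.comp (by fun_prop) fun y hy =>
        hab' ⟨by linarith [hy.1], by linarith [hy.2]⟩
    have := h1.abs_sq_sub_sq_le (sub_pos.2 hab) hc (s := s - a) (t := t - a)
      (by linarith [hs.1]) (by linarith) (by linarith [ht.2])
    simp only [Function.comp_def, hfwd, add_sub_cancel] at this
    rwa [intervalIntegral.integral_comp_add_left (fun x => |2 * f (γ x) * f' (γ x)|) a,
      add_sub_cancel, add_sub_cancel] at this
  · rw [dist_comm, hd] at h1
    have hc : ContinuousOn (f ∘ arcParam (γ b) (γ a)) (Ioo 0 (b - a)) := by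
      simp only [Function.comp_def, hbwd]
      exact hfγ.comp (by fun_prop) fun y hy =>
        hab' ⟨by linarith [hy.2], by linarith [hy.1]⟩
    have := h1.abs_sq_sub_sq_le (sub_pos.2 hab) hc (s := b - t) (t := b - s)
      (by linarith [ht.2]) (by linarith) (by linarith [hs.1])
    simp only [Function.comp_def, hbwd, sub_sub_cancel] at this
    rwa [intervalIntegral.integral_comp_sub_left (fun x => |2 * f (γ x) * f' (γ x)|) b,
      sub_sub_cancel, sub_sub_cancel, abs_sub_comm] at this

/-- The measure of the range is at most its diameter, which the increment estimate bounds. -/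
theorem volume_image_segment_le (hh : 0 < h) {f f' : Plane → ℝ} (hf : ContinuousOn f T.graph)
    (hf' : T.IsDeriv f f') (hi : Integrable (fun x => 2 * f x * f' x) T.lengthMeasure)
    (n : ℕ) {p q : Plane} (hpq : p ≠ q) (hp : p ∈ T.vertices) (hq : q ∈ T.vertices)
    (hsub : segment ℝ p q ⊆ (T.tile n).boundary) :
    volume ((fun x => f x ^ 2) '' segment ℝ p q) ≤
      ∫⁻ x in segment ℝ p q, ‖2 * f x * f' x‖ₑ ∂(μH[1] : Measure Plane) := by
  obtain ⟨hint, hle⟩ := hT.abs_sq_sub_sq_le hh hf hf' hi n hpq hp hq hsub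
  refine (Real.volume_le_diam _).trans (Metric.ediam_le ?_)
  have key : ∀ s t, 0 ≤ s → s ≤ t → t ≤ dist p q →
      edist (f (arcParam p q t) ^ 2) (f (arcParam p q s) ^ 2) ≤
        ∫⁻ x in segment ℝ p q, ‖2 * f x * f' x‖ₑ ∂(μH[1] : Measure Plane) := by
    intro s t hs hst ht
    rw [← image_arcParam_Icc hpq, (isometry_arcParam hpq).lintegral_image, edist_dist,
      Real.dist_eq]
    have hsub' : Ioc s t ⊆ Icc 0 (dist p q) := fun x hx =>
      ⟨hs.trans hx.1.le, hx.2.trans ht⟩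
    calc _ ≤ ENNReal.ofReal (∫ x in s..t, |2 * f (arcParam p q x) * f' (arcParam p q x)|) :=
          ENNReal.ofReal_le_ofReal (hle s t hs hst ht)
      _ = ∫⁻ x in Ioc s t, ‖2 * f (arcParam p q x) * f' (arcParam p q x)‖ₑ := by
          rw [intervalIntegral.integral_of_le hst, ofReal_integral_eq_lintegral_ofReal
            (hint.mono_set hsub') (Filter.Eventually.of_forall fun x => abs_nonneg _)]
          simp only [← Real.enorm_eq_ofReal_abs]
      _ ≤ _ := lintegral_mono_set hsub'
  rintro _ ⟨x, hx, rfl⟩ _ ⟨y, hy, rfl⟩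
  rw [← image_arcParam_Icc hpq] at hx hy
  obtain ⟨s, hs, rfl⟩ := hx
  obtain ⟨t, ht, rfl⟩ := hy
  rcases le_total s t with hst | hst
  · rw [edist_comm]
    exact key s t hs.1 hst ht.2
  · exact key t s ht.1 hst hs.2

theorem volume_image_boundary_le (hh : 0 < h) {f f' : Plane → ℝ} (hf : ContinuousOn f T.graph)
    (hf' : T.IsDeriv f f') (hi : Integrable (fun x => 2 * f x * f' x) T.lengthMeasure) (n : ℕ) :
    volume ((fun x => f x ^ 2) '' (T.tile n).boundary) ≤
      ∫⁻ x in (T.tile n).boundary, ‖2 * f x * f' x‖ₑ ∂(μH[1] : Measure Plane) := by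
  rw [(T.tile n).lintegral_boundary, ConvexPolygon.boundary, Polygon.boundary, image_iUnion]
  refine (measure_iUnion_fintype_le _ _).trans (Finset.sum_le_sum fun i _ => ?_)
  have := (T.tile n).edgeSet_subset_boundary i
  rw [(T.tile n).edgeSet_eq] at this ⊢
  exact hT.volume_image_segment_le hh hf hf' hi n ((T.tile n).poly_ne i)
    (hT.corner_mem_vertices hh n i) (hT.corner_mem_vertices hh n _) this

end Admissible

end PolygonalTiling

/-! ### Slicing by coordinate lines and the embedding of `W^{1,1}` into `L²`. -/

theorem lintegral_plane_mul {a b : ℝ → ℝ≥0∞} (ha : Measurable a) (hb : Measurable b) :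
    ∫⁻ z : Plane, a (z 0) * b (z 1) = (∫⁻ x, a x) * ∫⁻ y, b y := by
  have h1 : MeasurePreserving (fun z : Plane => (z 0, z 1)) volume volume :=
    (volume_preserving_finTwoArrow ℝ).comp (PiLp.volume_preserving_ofLp (Fin 2))
  rw [h1.lintegral_comp (f := fun p : ℝ × ℝ => a p.1 * b p.2) (by fun_prop),
    Measure.volume_eq_prod, lintegral_prod_mul ha.aemeasurable hb.aemeasurable]

theorem abs_apply_sub_le_dist (x y : Plane) (k : Fin 2) : dist (x k) (y k) ≤ dist x y := by
  rw [dist_eq_norm, dist_eq_norm]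
  simpa using PiLp.norm_apply_le (x - y) k

theorem isPreconnected_line (k : Fin 2) (x : ℝ) : IsPreconnected {z : Plane | z k = x} := by
  apply Convex.isPreconnected
  intro y hy z hz s t _ _ hst
  have hy : y k = x := hy
  have hz : z k = x := hz
  change (s • y + t • z) k = x
  simp [hy, hz, ← add_mul, hst]

namespace PolygonalTiling

/-- A line parallel to a coordinate axis meets infinitely many tiles. -/
theorem infinite_tiles_line (T : PolygonalTiling) (k : Fin 2) (x : ℝ) :
    {n | ∃ z ∈ (T.tile n).carrier, z k = x}.Infinite := by
  intro hfin
  -- Finitely many compact tiles would cover the line, yet its other coordinate is unbounded.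
  obtain ⟨j, hj⟩ := exists_ne k
  have hc := hfin.isCompact_biUnion fun n _ => (T.tile n).isCompact_carrier
  have hc' := hc.image (f := fun z : Plane => z j) (by fun_prop)
  refine NoncompactSpace.noncompact_univ (X := ℝ) ?_
  convert hc'
  symm
  rw [eq_univ_iff_forall]
  intro t
  let z : Plane := WithLp.toLp 2 fun i => if i = k then x else t
  obtain ⟨n, hn⟩ := T.exists_mem_carrier z
  exact ⟨z, mem_iUnion₂.2 ⟨n, ⟨z, hn, by simp [z]⟩, hn⟩, by simp [z, hj]⟩

variable {T : PolygonalTiling} {h H M : ℝ}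

namespace Admissible

variable (hT : T.Admissible h H M)
include hT

/-- The values of an integrable function on the boundaries of the tiles meeting a line are bounded
by the total length of its ranges on these boundaries. -/
theorem le_tsum_volume_image (hh : 0 < h) {u : Plane → ℝ} (hu : ContinuousOn u T.graph)
    (hui : ∫⁻ z, ENNReal.ofReal (u z) ∂T.lengthMeasure ≠ ⊤) {k : Fin 2} {n₀ : ℕ} {y z₀ : Plane}
    (hy : y ∈ (T.tile n₀).carrier) (hz₀ : z₀ ∈ (T.tile n₀).boundary) :
    ENNReal.ofReal (u z₀) ≤
      ∑' n, ((fun z : Plane => z k) '' (T.tile n).carrier).indicator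
        (fun _ => volume (u '' (T.tile n).boundary)) (y k) := by
  set x := y k with hx
  set A := {n | ∃ z ∈ (T.tile n).carrier, z k = x} with hA
  have hn₀ : n₀ ∈ A := ⟨y, hy, rfl⟩
  have hRHS : ∑' n, ((fun z : Plane => z k) '' (T.tile n).carrier).indicator
      (fun _ => volume (u '' (T.tile n).boundary)) x = ∑' n : A, volume (u '' (T.tile n).boundary) := by
    rw [tsum_subtype A fun n => volume (u '' (T.tile n).boundary)]
    refine tsum_congr fun n => ?_
    by_cases hn : n ∈ A
    · rw [indicator_of_mem hn]
      exact indicator_of_mem (s := (fun z : Plane => z k) '' (T.tile n).carrier) hn _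
    · rw [indicator_of_notMem hn]
      exact indicator_of_notMem (s := (fun z : Plane => z k) '' (T.tile n).carrier) hn _
  rw [hRHS]
  -- It suffices that every level below `u z₀` is attained on the boundary of some tile meeting the
  -- line.
  suffices hsub : Ioo 0 (u z₀) ⊆ ⋃ n : A, u '' (T.tile n).boundary by
    have := (measure_mono (μ := volume) hsub).trans (measure_iUnion_le _)
    rwa [Real.volume_Ioo, sub_zero] at this
  intro c hc
  by_contra hcn
  have hcn : ∀ n ∈ A, c ∉ u '' (T.tile n).boundary := fun n hn h =>
    hcn (mem_iUnion.2 ⟨⟨n, hn⟩, h⟩)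
  have hdich : ∀ n ∈ A, (∀ z ∈ (T.tile n).boundary, c < u z) ∨
      ∀ z ∈ (T.tile n).boundary, u z < c := by
    intro n hn
    by_contra! hcon
    obtain ⟨⟨p, hp, hpc⟩, q, hq, hqc⟩ := hcon
    exact hcn n hn ((T.tile n).isPreconnected_boundary.intermediate_value hp hq
      (hu.mono (boundary_subset_graph n)) ⟨hpc, hqc⟩)
  have hclosed : ∀ p : ℕ → Prop, IsClosed (⋃ n : {n // p n}, (T.tile n).carrier) := fun p =>
    ((hT.locallyFinite hh).comp_injective Subtype.val_injective).isClosed_iUnion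
      fun n => (T.tile n).isCompact_carrier.isClosed
  have hall : ∀ n ∈ A, ∀ z ∈ (T.tile n).boundary, c < u z := by
    intro n hn
    refine (hdich n hn).resolve_right fun hlt => ?_
    obtain ⟨z, hzn, hzx⟩ := hn
    -- The tiles with `u > c` and those with `u < c` on the boundary cover the line by two closed
    -- sets, which meet by connectedness. A common point lies on the boundaries of two distinct
    -- tiles, so `u` would be both above and below `c` there.
    obtain ⟨w, -, hw, hw'⟩ := isPreconnected_closed_iff.1 (isPreconnected_line k x) _ _
      (hclosed fun n => n ∈ A ∧ ∀ z ∈ (T.tile n).boundary, c < u z)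
      (hclosed fun n => n ∈ A ∧ ∀ z ∈ (T.tile n).boundary, u z < c)
      (fun v hv => by
        obtain ⟨m, hm⟩ := T.exists_mem_carrier v
        have hmA : m ∈ A := ⟨v, hm, hv⟩
        exact (hdich m hmA).imp (fun h => mem_iUnion.2 ⟨⟨m, hmA, h⟩, hm⟩)
          fun h => mem_iUnion.2 ⟨⟨m, hmA, h⟩, hm⟩)
      ⟨y, rfl, mem_iUnion.2 ⟨⟨n₀, hn₀,
        (hdich n₀ hn₀).resolve_right fun h => (h z₀ hz₀).not_gt hc.2⟩, hy⟩⟩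
      ⟨z, hzx, mem_iUnion.2 ⟨⟨n, ⟨z, hzn, hzx⟩, hlt⟩, hzn⟩⟩
    obtain ⟨⟨m₁, hm₁, hm₁'⟩, hw₁⟩ := mem_iUnion.1 hw
    obtain ⟨⟨m₂, hm₂, hm₂'⟩, hw₂⟩ := mem_iUnion.1 hw'
    have hne : m₁ ≠ m₂ := by
      rintro rfl
      obtain ⟨v, hv⟩ := (T.tile m₁).boundary_nonempty
      exact lt_asymm (hm₁' v hv) (hm₂' v hv)
    exact lt_asymm (hm₁' w (T.inter_subset _ _ hne ⟨hw₁, hw₂⟩))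
      (hm₂' w (T.inter_subset _ _ hne.symm ⟨hw₂, hw₁⟩))
  have : Infinite A := (T.infinite_tiles_line k x).to_subtype
  -- Each of the infinitely many tiles meeting the line contributes at least `c * (h / 2)` to the
  -- integral of `u`; with bounded multiplicity this contradicts integrability.
  have hε : ENNReal.ofReal c * ENNReal.ofReal (h / 2) ≠ 0 :=
    mul_ne_zero (ENNReal.ofReal_pos.2 hc.1).ne' (ENNReal.ofReal_pos.2 (by linarith)).ne'
  refine ENNReal.mul_ne_top (ENNReal.div_ne_top
    (measure_closedBall_lt_top (x := (0 : Plane)) (r := 2 * M)).ne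
    (Metric.measure_ball_pos volume (0 : Plane) hh).ne') hui
    (top_le_iff.1 (le_trans ?_ (hT.tsum_lintegral_boundary_le hh _)))
  rw [← ENNReal.tsum_const_eq_top_of_ne_zero (α := A) hε]
  refine le_trans (ENNReal.tsum_le_tsum fun n => ?_)
    (ENNReal.tsum_comp_le_tsum_of_injective (f := ((↑) : A → ℕ)) Subtype.val_injective
      fun n => ∫⁻ z in (T.tile n).boundary, ENNReal.ofReal (u z) ∂(μH[1] : Measure Plane))
  calc ENNReal.ofReal c * ENNReal.ofReal (h / 2)
      ≤ ENNReal.ofReal c * μH[1] (T.tile n).boundary := by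
        rw [(T.tile n).hausdorffMeasure_boundary]
        gcongr
        linarith [hT.le_two_mul_perimeter hh n]
    _ = ∫⁻ z in (T.tile n).boundary, ENNReal.ofReal c ∂(μH[1] : Measure Plane) :=
        (setLIntegral_const _ _).symm
    _ ≤ _ := setLIntegral_mono' (T.tile n).measurableSet_boundary fun z hz =>
        ENNReal.ofReal_le_ofReal (hall n n.2 z hz).le

theorem volume_proj_le (n : ℕ) (k : Fin 2) :
    volume ((fun z : Plane => z k) '' (T.tile n).carrier) ≤ ENNReal.ofReal (2 * M) := by
  refine (Real.volume_le_diam _).trans (Metric.ediam_le ?_)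
  rintro _ ⟨y, hy, rfl⟩ _ ⟨z, hz, rfl⟩
  rw [edist_dist]
  exact ENNReal.ofReal_le_ofReal ((abs_apply_sub_le_dist y z k).trans (hT.dist_le hy hz))

/-- The embedding of `W^{1,1}` into `L²` on the one-skeleton, applied to `f²`. -/
theorem sobolev (hh : 0 < h) {f f' : Plane → ℝ} (hf : ContinuousOn f T.graph)
    (hf' : T.IsDeriv f f') (hi : Integrable (fun x => 2 * f x * f' x) T.lengthMeasure)
    (hf2 : ∫⁻ z, ENNReal.ofReal (f z ^ 2) ∂T.lengthMeasure ≠ ⊤) :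
    volume (Metric.ball (0 : Plane) h) * ∫⁻ z, ENNReal.ofReal (f z ^ 2) ^ 2 ∂T.lengthMeasure ≤
      ENNReal.ofReal M * (ENNReal.ofReal (2 * M) *
        (volume (Metric.closedBall (0 : Plane) (2 * M)) / volume (Metric.ball (0 : Plane) h) *
          ∫⁻ x, ‖2 * f x * f' x‖ₑ ∂T.lengthMeasure)) ^ 2 := by
  let D : ℕ → ℝ≥0∞ := fun n =>
    ∫⁻ x in (T.tile n).boundary, ‖2 * f x * f' x‖ₑ ∂(μH[1] : Measure Plane)
  let pr : Fin 2 → ℕ → Set ℝ := fun k n => (fun z : Plane => z k) '' (T.tile n).carrier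
  have hpr : ∀ k n, MeasurableSet (pr k n) := fun k n =>
    ((T.tile n).isCompact_carrier.image (by fun_prop)).measurableSet
  -- `S k x` is the total variation bound carried by the tiles that meet the line where the `k`-th
  -- coordinate equals `x`.
  let S : Fin 2 → ℝ → ℝ≥0∞ := fun k x => ∑' n, (pr k n).indicator (fun _ => D n) x
  have hSm : ∀ k, Measurable (S k) := fun k =>
    Measurable.tsum fun n => measurable_const.indicator (hpr k n)
  have hS : ∀ k, ∫⁻ x, S k x ≤ ENNReal.ofReal (2 * M) * ∑' n, D n := by
    intro k
    simp only [S]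
    rw [lintegral_tsum fun n => (measurable_const.indicator (hpr k n)).aemeasurable,
      ← ENNReal.tsum_mul_left]
    refine ENNReal.tsum_le_tsum fun n => ?_
    rw [lintegral_indicator_const (hpr k n), mul_comm]
    gcongr
    exact hT.volume_proj_le n k
  let m : ℕ → ℝ≥0∞ := fun n => ⨆ z ∈ (T.tile n).boundary, ENNReal.ofReal (f z ^ 2)
  have hm : ∀ n k, ∀ y ∈ (T.tile n).carrier, m n ≤ S k (y k) := by
    intro n k y hy
    refine iSup₂_le fun z hz => ?_
    refine (hT.le_tsum_volume_image hh (u := fun z => f z ^ 2) (k := k) (hf.pow 2) hf2 hy hz).trans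
      (ENNReal.tsum_le_tsum fun l => indicator_le_indicator ?_)
    exact hT.volume_image_boundary_le hh hf hf' hi l
  -- On the ball inside the `n`-th tile, one factor of `m n ^ 2` is bounded by a function of the
  -- first coordinate and the other by a function of the second.
  have hsum : volume (Metric.ball (0 : Plane) h) * ∑' n, m n ^ 2 ≤
      (ENNReal.ofReal (2 * M) * ∑' n, D n) ^ 2 := by
    calc volume (Metric.ball (0 : Plane) h) * ∑' n, m n ^ 2
        = ∑' n, ∫⁻ y in Metric.ball (hT.center n) h, m n ^ 2 := by
          rw [← ENNReal.tsum_mul_left]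
          refine tsum_congr fun n => ?_
          rw [setLIntegral_const, mul_comm,
            Measure.addHaar_ball_center volume (hT.center n) h]
      _ ≤ ∑' n, ∫⁻ y in Metric.ball (hT.center n) h, S 0 (y 0) * S 1 (y 1) := by
          refine ENNReal.tsum_le_tsum fun n =>
            setLIntegral_mono' measurableSet_ball fun y hy => ?_
          have hy := interior_subset (hT.ball_center_subset n hy)
          rw [sq]
          exact mul_le_mul' (hm n 0 y hy) (hm n 1 y hy)
      _ = ∫⁻ y in ⋃ n, Metric.ball (hT.center n) h, S 0 (y 0) * S 1 (y 1) :=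
          (lintegral_iUnion (fun _ => measurableSet_ball) hT.pairwise_disjoint_ball _).symm
      _ ≤ ∫⁻ y : Plane, S 0 (y 0) * S 1 (y 1) := setLIntegral_le_lintegral _ _
      _ = (∫⁻ x, S 0 x) * ∫⁻ x, S 1 x := lintegral_plane_mul (hSm 0) (hSm 1)
      _ ≤ _ := by
          rw [sq]
          exact mul_le_mul' (hS 0) (hS 1)
  calc volume (Metric.ball (0 : Plane) h) * ∫⁻ z, ENNReal.ofReal (f z ^ 2) ^ 2 ∂T.lengthMeasure
      ≤ volume (Metric.ball (0 : Plane) h) * ∑' n, m n ^ 2 * ENNReal.ofReal M := by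
        gcongr
        refine (lintegral_iUnion_le (fun n => (T.tile n).boundary) _).trans
          (ENNReal.tsum_le_tsum fun n => ?_)
        calc _ ≤ ∫⁻ z in (T.tile n).boundary, m n ^ 2 ∂(μH[1] : Measure Plane) :=
              setLIntegral_mono' (T.tile n).measurableSet_boundary fun z hz =>
                pow_le_pow_left' (le_iSup₂ (f := fun z (_ : z ∈ (T.tile n).boundary) =>
                  ENNReal.ofReal (f z ^ 2)) z hz) 2
          _ = m n ^ 2 * μH[1] (T.tile n).boundary := setLIntegral_const _ _
          _ ≤ _ := by
              rw [(T.tile n).hausdorffMeasure_boundary]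
              gcongr
              exact hT.perimeter_le n
    _ = ENNReal.ofReal M * (volume (Metric.ball (0 : Plane) h) * ∑' n, m n ^ 2) := by
        rw [ENNReal.tsum_mul_right]
        ring
    _ ≤ ENNReal.ofReal M * (ENNReal.ofReal (2 * M) * ∑' n, D n) ^ 2 := by gcongr
    _ ≤ _ := by
        gcongr
        exact hT.tsum_lintegral_boundary_le hh _

end Admissible

end PolygonalTiling

/-! ### Hölder inequalities and the conclusion. -/

theorem lintegral_mul_sq_le {α : Type*} [MeasurableSpace α] {μ : Measure α} {a b : α → ℝ≥0∞}
    (ha : AEMeasurable a μ) (hb : AEMeasurable b μ) :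
    (∫⁻ x, a x * b x ∂μ) ^ 2 ≤ (∫⁻ x, a x ^ 2 ∂μ) * ∫⁻ x, b x ^ 2 ∂μ := by
  have h := ENNReal.lintegral_mul_le_Lp_mul_Lq μ Real.HolderConjugate.two_two ha hb
  simp only [Pi.mul_apply, ENNReal.rpow_two] at h
  calc _ ≤ ((∫⁻ x, a x ^ 2 ∂μ) ^ (1 / 2 : ℝ) * (∫⁻ x, b x ^ 2 ∂μ) ^ (1 / 2 : ℝ)) ^ 2 :=
        pow_le_pow_left' h 2
    _ = _ := by
        rw [mul_pow, ← ENNReal.rpow_two, ← ENNReal.rpow_two, ← ENNReal.rpow_mul,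
          ← ENNReal.rpow_mul]
        norm_num

/-- Hölder with exponents `3/2` and `3` for the splitting `a² = a^(2/3) · a^(4/3)`: an interpolation
of `L²` between `L¹` and `L⁴`. -/
theorem lintegral_sq_pow_three_le {α : Type*} [MeasurableSpace α] {μ : Measure α} {a : α → ℝ≥0∞}
    (ha : AEMeasurable a μ) :
    (∫⁻ x, a x ^ 2 ∂μ) ^ 3 ≤ (∫⁻ x, a x ∂μ) ^ 2 * ∫⁻ x, a x ^ 4 ∂μ := by
  have hpq : (3 / 2 : ℝ).HolderConjugate 3 := by
    rw [Real.holderConjugate_iff]; norm_num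
  have h := ENNReal.lintegral_mul_le_Lp_mul_Lq μ hpq (ha.pow_const (2 / 3 : ℝ))
    (ha.pow_const (4 / 3 : ℝ))
  have h1 : ∀ x, a x ^ (2 / 3 : ℝ) * a x ^ (4 / 3 : ℝ) = a x ^ 2 := fun x => by
    rw [← ENNReal.rpow_add_of_nonneg _ _ (by norm_num) (by norm_num), ← ENNReal.rpow_natCast]
    norm_num
  have h2 : ∀ x, (a x ^ (2 / 3 : ℝ)) ^ (3 / 2 : ℝ) = a x := fun x => by
    rw [← ENNReal.rpow_mul]; norm_num
  have h3 : ∀ x, (a x ^ (4 / 3 : ℝ)) ^ (3 : ℝ) = a x ^ 4 := fun x => by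
    rw [← ENNReal.rpow_mul, ← ENNReal.rpow_natCast]; norm_num
  simp only [Pi.mul_apply, h1, h2, h3] at h
  calc _ ≤ ((∫⁻ x, a x ∂μ) ^ (1 / (3 / 2) : ℝ) * (∫⁻ x, a x ^ 4 ∂μ) ^ (1 / 3 : ℝ)) ^ 3 :=
        pow_le_pow_left' h 3
    _ = _ := by
        rw [mul_pow, ← ENNReal.rpow_natCast, ← ENNReal.rpow_natCast, ← ENNReal.rpow_mul,
          ← ENNReal.rpow_mul, ← ENNReal.rpow_natCast]
        norm_num

theorem MeasureTheory.MemLp.lpNorm_two_sq {α : Type*} [MeasurableSpace α] {μ : Measure α}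
    {f : α → ℝ} (hf : MemLp f 2 μ) : lpNorm f 2 μ ^ 2 = (∫⁻ x, ‖f x‖ₑ ^ 2 ∂μ).toReal := by
  rw [← toReal_eLpNorm hf.aestronglyMeasurable,
    eLpNorm_eq_lintegral_rpow_enorm_toReal (by norm_num) (by norm_num), ← ENNReal.toReal_pow,
    ← ENNReal.rpow_natCast, ← ENNReal.rpow_mul]
  norm_num

theorem MeasureTheory.MemLp.lintegral_enorm_sq_ne_top {α : Type*} [MeasurableSpace α]
    {μ : Measure α} {f : α → ℝ} (hf : MemLp f 2 μ) : ∫⁻ x, ‖f x‖ₑ ^ 2 ∂μ ≠ ⊤ := by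
  have := lintegral_rpow_enorm_lt_top_of_eLpNorm_lt_top (by norm_num) (by norm_num) hf.2
  simpa using this.ne

theorem theorem2p2 (h H M : ℝ) (hh : 0 < h) :
    ∃ β : ℝ, 0 < β ∧
      ∀ T : PolygonalTiling, T.Admissible h H M →
        ∀ f : Plane → ℝ, T.MemH1 f → MemLp f 1 T.lengthMeasure → (∀ x ∈ T.graph, 0 ≤ f x) →
          lpNorm f 2 T.lengthMeasure ^ 4 ≤
            β * T.energy f * lpNorm f 1 T.lengthMeasure ^ 2 := by
  set v := volume (Metric.ball (0 : Plane) h)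
  have hv0 : v ≠ 0 := (Metric.measure_ball_pos _ _ hh).ne'
  have hvt : v ≠ ⊤ := measure_ball_lt_top.ne
  set C : ℝ≥0∞ := ENNReal.ofReal M * (ENNReal.ofReal (2 * M) *
    (volume (Metric.closedBall (0 : Plane) (2 * M)) / v) * 2) ^ 2 with hC
  have hCt : C ≠ ⊤ := by
    refine ENNReal.mul_ne_top ENNReal.ofReal_ne_top (ENNReal.pow_ne_top (ENNReal.mul_ne_top
      (ENNReal.mul_ne_top ENNReal.ofReal_ne_top (ENNReal.div_ne_top
        measure_closedBall_lt_top.ne hv0)) (by norm_num)))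
  have hvr : 0 < v.toReal := ENNReal.toReal_pos hv0 hvt
  -- The summand `1` only guarantees positivity, since no sign of `M` is assumed and `C` could be
  -- zero.
  refine ⟨C.toReal / v.toReal + 1, by positivity, fun T hT f hf hf1 _ => ?_⟩
  rw [PolygonalTiling.energy, dif_pos hf]
  obtain ⟨hderiv, hf'⟩ := hf.2.2.choose_spec
  set f' := hf.2.2.choose
  have hf2 := hf.1
  set μ := T.lengthMeasure
  set X := ∫⁻ x, ‖f x‖ₑ ^ 2 ∂μ with hX
  set Y := ∫⁻ x, ‖f' x‖ₑ ^ 2 ∂μ with hY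
  set Z := ∫⁻ x, ‖f x‖ₑ ∂μ with hZ
  have hXt : X ≠ ⊤ := hf2.lintegral_enorm_sq_ne_top
  have hYt : Y ≠ ⊤ := hf'.lintegral_enorm_sq_ne_top
  have hZe : Z = eLpNorm f 1 μ := eLpNorm_one_eq_lintegral_enorm.symm
  have hZt : Z ≠ ⊤ := hZe ▸ hf1.2.ne
  have hl1 : lpNorm f 1 μ = Z.toReal := by
    rw [hZe, toReal_eLpNorm hf1.aestronglyMeasurable]
  have hl2 : lpNorm f 2 μ ^ 4 = X.toReal ^ 2 := by
    rw [hX, ← hf2.lpNorm_two_sq]; ring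
  have hQ : ∫ x, f' x ^ 2 ∂μ = Y.toReal := by
    rw [integral_eq_lintegral_of_nonneg_ae (Filter.Eventually.of_forall fun x => sq_nonneg _)
      (hf'.aestronglyMeasurable.pow 2)]
    simp only [← enorm_pow, hY, Real.enorm_of_nonneg (sq_nonneg _)]
  have hi : Integrable (fun x => 2 * f x * f' x) μ := by
    have := (hf2.integrable_mul hf').const_mul 2
    simpa only [mul_assoc, Pi.mul_apply] using this
  have hsq : ∀ x, ENNReal.ofReal (f x ^ 2) = ‖f x‖ₑ ^ 2 := fun x => by
    rw [← enorm_pow, Real.enorm_of_nonneg (sq_nonneg _)]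
  have hsob := hT.sobolev hh hf.2.1 hderiv hi (by simpa only [hsq] using hXt)
  simp only [hsq, ← pow_mul, Nat.reduceMul] at hsob
  have hfm : AEMeasurable (fun x => ‖f x‖ₑ) μ := hf2.aestronglyMeasurable.enorm
  have hcs : (∫⁻ x, ‖2 * f x * f' x‖ₑ ∂μ) ^ 2 ≤ 2 ^ 2 * (X * Y) := by
    have h2 : ‖(2 : ℝ)‖ₑ = 2 := by
      rw [Real.enorm_of_nonneg (by norm_num)]; simp
    simp only [enorm_mul, mul_assoc, h2]
    rw [lintegral_const_mul' _ _ (by norm_num), mul_pow]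
    gcongr
    exact lintegral_mul_sq_le hfm hf'.aestronglyMeasurable.enorm
  have hfin : v * X ^ 3 ≤ C * (Z ^ 2 * X * Y) := by
    calc v * X ^ 3 ≤ v * (Z ^ 2 * ∫⁻ x, ‖f x‖ₑ ^ 4 ∂μ) := by
          gcongr
          exact lintegral_sq_pow_three_le hfm
      _ = Z ^ 2 * (v * ∫⁻ x, ‖f x‖ₑ ^ 4 ∂μ) := by ring
      _ ≤ Z ^ 2 * _ := mul_le_mul_right hsob _
      _ = Z ^ 2 * (ENNReal.ofReal M * (ENNReal.ofReal (2 * M) *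
          (volume (Metric.closedBall (0 : Plane) (2 * M)) / v)) ^ 2) *
            (∫⁻ x, ‖2 * f x * f' x‖ₑ ∂μ) ^ 2 := by ring
      _ ≤ Z ^ 2 * (ENNReal.ofReal M * (ENNReal.ofReal (2 * M) *
          (volume (Metric.closedBall (0 : Plane) (2 * M)) / v)) ^ 2) * (2 ^ 2 * (X * Y)) := by
          gcongr
      _ = _ := by rw [hC]; ring
  rw [hl1, hl2, hQ]
  have hreal := ENNReal.toReal_mono (by finiteness) hfin
  simp only [ENNReal.toReal_mul, ENNReal.toReal_pow] at hreal
  have hx0 : 0 ≤ X.toReal := ENNReal.toReal_nonneg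
  have hy0 : 0 ≤ Y.toReal := ENNReal.toReal_nonneg
  have hz0 : 0 ≤ Z.toReal := ENNReal.toReal_nonneg
  -- The common factor `X` can be cancelled only when nonzero; if it vanishes, so does the left
  -- side.
  rcases hx0.eq_or_lt with hx | hx
  · rw [← hx, zero_pow two_ne_zero]
    positivity
  · have h1 : v.toReal * X.toReal ^ 2 ≤ C.toReal * (Z.toReal ^ 2 * Y.toReal) := by
      refine le_of_mul_le_mul_right ?_ hx
      linarith
    have h2 : X.toReal ^ 2 ≤ C.toReal / v.toReal * (Z.toReal ^ 2 * Y.toReal) := by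
      rw [div_mul_eq_mul_div, le_div_iff₀ hvr]
      linarith
    have h3 : 0 ≤ Z.toReal ^ 2 * Y.toReal := by positivity
    linarith
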